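/- Let $n\ge 3$ and read all colours modulo $n$. Put $\alpha_i=\epsilon_i-\epsilon_{i+1}\in\mathbb Z^n$, $\bar\lambda_i=\lambda_i-\lambda_{i+1}$, and let $\Lambda(n,n)$ be the set of $\lambda\in\mathbb Z_{\ge0}^n$ with $\sum_i\lambda_i=n$. **The 2-category.** Let $\hat{\mathcal S}(n,n)$ be the following $\mathbb Q$-linear 2-category (2-morphisms of all degrees are allowed). Objects are the $\lambda\in\Lambda(n,n)$. The 1-morphisms are generated by $\mathcal E_{+i},\mathcal E_{-i}$ (colours $i$; $\mathcal E_{\pm i}$ changes the label $\lambda$ on its right into $\lambda\pm\alpha_i$ on its left) and $\mathcal E_{+\delta},\mathcal E_{-\delta}:(1^n)\to(1^n)$. The 2-morphisms are $\mathbb Q$-linear combinations of diagrams, read from bottom to top, generated by: upward and downward oriented strands (for $\mathcal E_{+}$ and $\mathcal E_{-}$) of colours $i$ and of type $\delta$; all oriented cups and caps; dots on coloured strands; crossings of two upward or of two downward coloured strands; and the $\delta$-splitters $\mathcal E_{+\delta}\to\mathcal E_{+i}\mathcal E_{+(i-1)}\cdots\mathcal E_{+(i+1)}$, $\mathcal E_{-\delta}\to\mathcal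 E_{-i}\mathcal E_{-(i+1)}\cdots\mathcal E_{-(i-1)}$ (each colour once), and the corresponding mergers in the opposite direction. Diagrams with a region whose label is not in $\Lambda(n,n)$, or with a $\delta$-strand not between regions labelled $(1^n)$, are zero. Write $x_c$ for a dot on the strand of colour $c$. The relations, imposed locally and in addition to the 2-category axioms, are the following. 1. Biadjointness of upward and downward strands (all zigzag relations, also for $\delta$), and full cyclicity: dots, crossings, splitters and mergers may be rotated by $180^\circ$ in either direction, with the same result (up to the evident change of orientation). 2. Upward strands. For equal colours: the double crossing is $0$, and a crossing with a dot at its top left minus one with a dot at its bottom right, and likewise one with a dot at its bottom left minus one with a dot at its top right, is the identity. For $i\neq j$ dots slide through crossings; the double crossing of colours $i,j$ is the identity if $j\ne i\pm1$, and is $x_{i+1}-x_i$ for the colours $i,i+1$ in either order. For three strands coloured $i,j,k$, the triple crossing that begins with the left crossing equals the one that begins with the right crossing, except for $i=k=j\pm1$, where their difference is $(+1)$ times the identity if $i=j+1$ and $(-1)$ times the identity if $i=j-1$. 3. For $i\ne j$ the sideways double crossings of $\mathcal E_{+j}\mathcal E_{-i}$ and of $\mathcal E_{-i}\mathcal E_{+j}$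 are identities. 4. Bubbles of colour $i$ in a region $\lambda$. A clockwise (resp. counter-clockwise) bubble with $\bar\lambda_i-1+k$ (resp. $-\bar\lambda_i-1+k$) dots has degree $2k$; denote it $c_k$ (resp. $\tilde c_k$). It is $0$ for $k<0$, and $c_0=(-1)^{\lambda_{i+1}}$, $\tilde c_0=-(-1)^{\lambda_{i+1}}$. Moreover $\sum_{a+b=k}\tilde c_a c_b=-\delta_{k,0}$ for $k\ge0$; this also defines the "fake" bubbles, with a negative number of dots. 5. Curls on an upward $i$-strand: a curl on the right of the strand equals $-\sum_{f=0}^{-\bar\lambda_i}x_i^{-\bar\lambda_i-f}c_f$, with $\lambda$ the label on the right of the strand and $c_f$ in that region; a curl on the left equals $\sum_{g=0}^{\bar\lambda_i}\tilde c_g x_i^{\bar\lambda_i-g}$, with $\lambda$ the label on the left and $\tilde c_g$ in that region. 6. On $\mathcal E_{+i}\mathcal E_{-i}1_\lambda$ the identity is the sideways double crossing minus $\sum_{a+b+k=\bar\lambda_i-1}(\text{cup with }a\text{ dots})\,\tilde c_k\,(\text{cap with }b\text{ dots})$; on $\mathcal E_{-i}\mathcal E_{+i}1_\lambda$ it is the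 sideways double crossing minus $\sum_{a+b+k=-\bar\lambda_i-1}(\text{cup with }a\text{ dots})\,c_k\,(\text{cap with }b\text{ dots})$. 7. $\delta$-bubbles of either orientation equal $1$, and a $\delta$-cap followed by the $\delta$-cup of the same type is the identity of two antiparallel $\delta$-strands. 8. Let $S_i:\mathcal E_{+\delta}\to\mathcal E_{+i}\mathcal E_{+(i-1)}\cdots\mathcal E_{+(i+1)}$ and $M_i$ be the upward splitter and merger, and for $i\neq j$ let $P_{ij}$ be the diagram in which the block of strands $(i,\dots,j+1)$ crosses the block $(j,\dots,i+1)$ (each pair from different blocks once, no others). Then $S_iM_i=x_{i+1}-x_i$; $S_jM_i=P_{ij}$ for $i\ne j$; $P_{i,j}S_i=(x_{i+1}-x_i)S_j$ for $j=i\pm1$; $M_iP_{i+1,i}=M_{i+1}(x_{i+1}-x_i)$ and $M_iP_{i-1,i}=M_{i-1}(x_{i+1}-x_i)$. 9. The composite $\mathcal E_{+\delta}\mathcal E_{-i}\to\mathcal E_{+(i-1)}\cdots\mathcal E_{+(i+1)}\to\mathcal E_{+\delta}\mathcal E_{-i}$ (split by $S_{i-1}$ and cap off the last strand $i$ with $\mathcal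 E_{-i}$; then the mirror image, with a cup and $M_{i-1}$) is the identity; likewise for $\mathcal E_{-i}\mathcal E_{+\delta}$ with $S_i$, $M_i$ and the first strand. **Statement.** Let $i$ be a colour and let $s_c\in\mathbb Z_{\ge0}$ for every colour $c$. Let $P_i(s)=M_i\bigl(\prod_c x_c^{s_c}\bigr)S_i\in\mathrm{END}(\mathcal E_{+\delta}1_{(1^n)})$ be the polygon: an upward $\delta$-strand splits into strands $i,i-1,\dots,i+1$, the strand of colour $c$ carries $s_c$ dots, and the strands merge again. In a region labelled $(1^n)$ let $\circlearrowright_c^{k}$ and $\circlearrowleft_c^{k}$ be the clockwise and counter-clockwise $c$-bubbles with $k$ dots, and put $$z_m=-\sum_{c=i-1,i-2,\dots,m}\circlearrowleft_c^0\ \ (z_i=0),\qquad y_m=\sum_{c=m,m-1,\dots,i+2}\circlearrowright_c^0\ \ (y_{i+1}=0),$$ where the sums run through consecutive decreasing colours modulo $n$. Let $\Sigma=\sum_c s_c$ and let $0^0=1$. Then, juxtaposition with the identity of $\mathcal E_{+\delta}$ being denoted by $\otimes$, $$P_i(s)=\sum_{\substack{0\le j_m\le s_m\\ m\ne i}}\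 \prod_{m\neq i}\binom{s_m}{j_m}\ \Bigl(z_{i-1}^{j_{i-1}}z_{i-2}^{j_{i-2}}\cdots z_{i+1}^{j_{i+1}}\circlearrowright_i^{\,\Sigma-\sum_{m\ne i} j_m}\Bigr)\otimes 1_{\mathcal E_{+\delta}}$$ and $$P_i(s)=\sum_{\substack{0\le j_m\le s_m\\ m\ne i+1}}\ \prod_{m\neq i+1}\binom{s_m}{j_m}\ 1_{\mathcal E_{+\delta}}\otimes\Bigl(y_{i}^{j_{i}}y_{i-1}^{j_{i-1}}\cdots y_{i+2}^{j_{i+2}}\circlearrowleft_{i+1}^{\,\Sigma-\sum_{m\ne i+1} j_m}\Bigr).$$ -/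

import Mathlib

/-!
The `2`-category of the affine `q`-Schur algebra `S(n,n)`, presented by generators and relations.

Colours are elements of `ZMod n`. A `1`-morphism `E_X 1_lam` is a word `X` in the letters `E i`, `F i`
(the latter is `E_{-i}`), `delta`, `delta'` (`E_{+delta}` and `E_{-delta}`), together with the label
`lam` of the rightmost region. Diagrams are read from bottom to top, words from left to right.

The `ℚ`-linear `2`-morphisms of all degrees are encoded by the path algebra `SchurTwo n` of the
presentation: it is generated by the identities `idn lam X` of the `1`-morphisms and by the slices
`sl lam A g B`, a generating `2`-morphism `g` with identity strands `A` on its left and `B` on its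
right, the rightmost region being labelled `lam`. Multiplication is vertical composition
(`x * y` is `x` on top of `y`, and is zero unless the words in the middle agree). So
`HOM(E_X 1_lam, E_Y 1_lam)` is `idn lam Y * SchurTwo n * idn lam X`. All relations are imposed with
arbitrary identity strands on the left and on the right, and disjoint slices satisfy the interchange
law, so horizontal composition is horizontal juxtaposition of diagrams.
-/

namespace AffineSchur

/-! ### Weights -/

/-- `gl_n`-weights: vectors in `ℤ^n`, the coordinates being indexed modulo `n`. -/
abbrev Weight (n : ℕ) := ZMod n → ℤ

/-- The simple root `alpha_i = epsilon_i - epsilon_{i+1}`. -/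
def simpleRoot {n : ℕ} (i : ZMod n) : Weight n := Pi.single i 1 - Pi.single (i + 1) 1

/-- `mu_i - mu_{i+1}`. -/
def bar {n : ℕ} (mu : Weight n) (i : ZMod n) : ℤ := mu i - mu (i + 1)

/-- The weight `(1^n)`. -/
def oneWt (n : ℕ) : Weight n := fun _ => 1

/-- Membership in `Lambda(n,n)`: nonnegative entries with sum `n`. -/
def IsSchurWeight {n : ℕ} [NeZero n] (mu : Weight n) : Prop :=
  (∀ j, 0 ≤ mu j) ∧ ∑ j, mu j = (n : ℤ)

/-! ### Words -/

/-- Strands: coloured upward strands `E i`, coloured downward strands `F i`,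
upward (`delta`) and downward (`delta'`) delta-strands. -/
inductive Letter (n : ℕ) : Type
  | E (i : ZMod n)
  | F (i : ZMod n)
  | delta
  | delta'

open Letter

/-- Reversal of the orientation of a strand. -/
def Letter.dual {n : ℕ} : Letter n → Letter n
  | E i => F i
  | F i => E i
  | delta => delta'
  | delta' => delta

/-- The weight of a letter. -/
def Letter.shift {n : ℕ} : Letter n → Weight n
  | E i => simpleRoot i
  | F i => -simpleRoot i
  | delta => 0
  | delta' => 0

/-- The word of a diagram rotated by 180 degrees. -/
def dualWord {n : ℕ} (X : List (Letter n)) : List (Letter n) := (X.map Letter.dual).reverse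

/-- The label of the region to the left of the word `X`, when the region to its right is `lam`. -/
def wt {n : ℕ} (lam : Weight n) : List (Letter n) → Weight n
  | [] => lam
  | a :: X => wt lam X + a.shift

/-- All region labels are in `Lambda(n,n)`, and delta-strands only occur between
regions labelled `(1^n)`. -/
def Admissible {n : ℕ} [NeZero n] (lam : Weight n) : List (Letter n) → Prop
  | [] => IsSchurWeight lam
  | a :: X => Admissible lam X ∧ IsSchurWeight (wt lam (a :: X)) ∧
      ((a = delta ∨ a = delta') → wt lam X = oneWt n)

/-- The colours `i, i-1, …, i-m+1`. -/
def run {n : ℕ} (i : ZMod n) (m : ℕ) : List (ZMod n) :=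
  (List.range m).map fun k => i - (k : ZMod n)

/-- The colours `i, i+1, …, i+m-1`. -/
def runUp {n : ℕ} (i : ZMod n) (m : ℕ) : List (ZMod n) :=
  (List.range m).map fun k => i + (k : ZMod n)

/-- Upward strands with the given colours. -/
def Es {n : ℕ} (U : List (ZMod n)) : List (Letter n) := U.map E

/-- Downward strands with the given colours. -/
def Fs {n : ℕ} (U : List (ZMod n)) : List (Letter n) := U.map F

/-! ### Generating 2-morphisms -/

/-- The generating `2`-morphisms: for every strand `a` with dual `a*` the cup `1 → a a*` and the
cap `a a* → 1`; dots; crossings; and the delta-splitters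
`splitE i : delta → E_i E_{i-1} … E_{i+1}`, `splitF i : delta' → F_i F_{i+1} … F_{i-1}`, `mergeE i`,
`mergeF i` (the same with source and target exchanged). -/
inductive Gen (n : ℕ) : Type
  | cup (a : Letter n)
  | cap (a : Letter n)
  | dotE (i : ZMod n)
  | dotF (i : ZMod n)
  | crossE (i j : ZMod n)
  | crossF (i j : ZMod n)
  | splitE (i : ZMod n)
  | splitF (i : ZMod n)
  | mergeE (i : ZMod n)
  | mergeF (i : ZMod n)

open Gen

/-- The bottom boundary of a generator. -/
def Gen.dom {n : ℕ} : Gen n → List (Letter n)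
  | cup _ => []
  | cap a => [a, a.dual]
  | dotE i => [E i]
  | dotF i => [F i]
  | crossE i j => [E i, E j]
  | crossF i j => [F i, F j]
  | splitE _ => [delta]
  | splitF _ => [delta']
  | mergeE i => Es (run i n)
  | mergeF i => Fs (runUp i n)

/-- The top boundary of a generator. -/
def Gen.cod {n : ℕ} : Gen n → List (Letter n)
  | cup a => [a, a.dual]
  | cap _ => []
  | dotE i => [E i]
  | dotF i => [F i]
  | crossE i j => [E j, E i]
  | crossF i j => [F j, F i]
  | splitE i => Es (run i n)
  | splitF i => Fs (runUp i n)
  | mergeE _ => [delta]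
  | mergeF _ => [delta']

/-- `Rotates g g'`: the generator `g'` is `g` rotated by 180 degrees. -/
inductive Rotates {n : ℕ} : Gen n → Gen n → Prop
  | dotE (i : ZMod n) : Rotates (dotE i) (dotF i)
  | dotF (i : ZMod n) : Rotates (dotF i) (dotE i)
  | crossE (i j : ZMod n) : Rotates (crossE i j) (crossF i j)
  | crossF (i j : ZMod n) : Rotates (crossF i j) (crossE i j)
  | splitE (i : ZMod n) : Rotates (splitE i) (mergeF (i + 1))
  | mergeF (i : ZMod n) : Rotates (mergeF i) (splitE (i - 1))
  | mergeE (i : ZMod n) : Rotates (mergeE i) (splitF (i + 1))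
  | splitF (i : ZMod n) : Rotates (splitF i) (mergeE (i - 1))

/-! ### Diagrams -/

/-- Identities and slices. -/
inductive Atom (n : ℕ) : Type
  | idn (lam : Weight n) (X : List (Letter n))
  | sl (lam : Weight n) (A : List (Letter n)) (g : Gen n) (B : List (Letter n))

/-- Formal `ℚ`-linear combinations of stacked slices. -/
abbrev Pre (n : ℕ) := FreeAlgebra ℚ (Atom n)

section Diagrams

variable {n : ℕ}

/-- The identity `2`-morphism of `E_X 1_lam`. -/
noncomputable def idn (lam : Weight n) (X : List (Letter n)) : Pre n :=
  FreeAlgebra.ι ℚ (Atom.idn lam X)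

/-- The generator `g` with identity strands `A` on the left and `B` on the right. -/
noncomputable def sl (lam : Weight n) (A : List (Letter n)) (g : Gen n) (B : List (Letter n)) :
    Pre n :=
  FreeAlgebra.ι ℚ (Atom.sl lam A g B)

/-- Nested caps `X X* → 1`. -/
noncomputable def nestedCap (lam : Weight n) :
    List (Letter n) → List (Letter n) → List (Letter n) → Pre n
  | A, [], B => idn lam (A ++ B)
  | A, a :: X, B => sl lam A (cap a) B * nestedCap lam (A ++ [a]) X (a.dual :: B)

/-- The dot on the left strand of `E_i E_j`. -/
noncomputable def dotL (lam : Weight n) (A : List (Letter n)) (i j : ZMod n)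
    (B : List (Letter n)) : Pre n :=
  sl lam A (dotE i) (E j :: B)

/-- The dot on the right strand of `E_i E_j`. -/
noncomputable def dotR (lam : Weight n) (A : List (Letter n)) (i j : ZMod n)
    (B : List (Letter n)) : Pre n :=
  sl lam (A ++ [E i]) (dotE j) B

/-- The triple crossing `E_i E_j E_k → E_k E_j E_i` whose lowest crossing is the left one. -/
noncomputable def braidL (lam : Weight n) (A : List (Letter n)) (i j k : ZMod n)
    (B : List (Letter n)) : Pre n :=
  sl lam A (crossE j k) (E i :: B) * sl lam (A ++ [E j]) (crossE i k) B *
    sl lam A (crossE i j) (E k :: B)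

/-- The triple crossing `E_i E_j E_k → E_k E_j E_i` whose lowest crossing is the right one. -/
noncomputable def braidR (lam : Weight n) (A : List (Letter n)) (i j k : ZMod n)
    (B : List (Letter n)) : Pre n :=
  sl lam (A ++ [E k]) (crossE i j) B * sl lam A (crossE i k) (E j :: B) *
    sl lam (A ++ [E i]) (crossE j k) B

/-- The sideways crossing `E_j F_i → F_i E_j`. -/
noncomputable def sideR (lam : Weight n) (A : List (Letter n)) (j i : ZMod n)
    (B : List (Letter n)) : Pre n :=
  sl lam (A ++ [F i, E j]) (cap (E i)) B * sl lam (A ++ [F i]) (crossE i j) (F i :: B) *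
    sl lam A (cup (F i)) (E j :: F i :: B)

/-- The sideways crossing `F_i E_j → E_j F_i`. -/
noncomputable def sideL (lam : Weight n) (A : List (Letter n)) (i j : ZMod n)
    (B : List (Letter n)) : Pre n :=
  sl lam A (cap (F i)) (E j :: F i :: B) * sl lam (A ++ [F i]) (crossE j i) (F i :: B) *
    sl lam (A ++ [F i, E j]) (cup (E i)) B

/-- The clockwise `i`-bubble with `k ≥ 0` dots, between the strands `A` and `B`. -/
noncomputable def cbub (lam : Weight n) (A : List (Letter n)) (i : ZMod n) (k : ℕ)
    (B : List (Letter n)) : Pre n :=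
  sl lam A (cap (E i)) B * sl lam A (dotE i) (F i :: B) ^ k * sl lam A (cup (E i)) B

/-- The counter-clockwise `i`-bubble with `k ≥ 0` dots, between the strands `A` and `B`. -/
noncomputable def ccbub (lam : Weight n) (A : List (Letter n)) (i : ZMod n) (k : ℕ)
    (B : List (Letter n)) : Pre n :=
  sl lam A (cap (F i)) B * sl lam (A ++ [F i]) (dotE i) B ^ k * sl lam A (cup (F i)) B

/-- The sign `(-1)^{mu_{i+1}}`, where `mu` labels the region to the left of `B`. -/
noncomputable def bubSign (lam : Weight n) (i : ZMod n) (B : List (Letter n)) : ℚ :=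
  (-1 : ℚ) ^ (wt lam B (i + 1))

/-- Fake clockwise bubbles of degree `2k`, i.e. the solution of the homogeneous terms of the
infinite Grassmannian relation. Only used if `mu_i - mu_{i+1} - 1 + k < 0`, when the
counter-clockwise bubbles of positive degree are all real. -/
noncomputable def fakeC (lam : Weight n) (A : List (Letter n)) (i : ZMod n)
    (B : List (Letter n)) : ℕ → Pre n
  | 0 => bubSign lam i B • idn lam (A ++ B)
  | k + 1 => bubSign lam i B • ∑ a : Fin (k + 1),
      ccbub lam A i (-bar (wt lam B) i + (a : ℕ)).toNat B * fakeC lam A i B (k - a)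

/-- Fake counter-clockwise bubbles of degree `2k`. Only used if
`-(mu_i - mu_{i+1}) - 1 + k < 0`, when the clockwise bubbles of positive degree are all real. -/
noncomputable def fakeCC (lam : Weight n) (A : List (Letter n)) (i : ZMod n)
    (B : List (Letter n)) : ℕ → Pre n
  | 0 => (-bubSign lam i B) • idn lam (A ++ B)
  | k + 1 => (-bubSign lam i B) • ∑ a : Fin (k + 1),
      cbub lam A i (bar (wt lam B) i + (a : ℕ)).toNat B * fakeCC lam A i B (k - a)

/-- The (real or fake) clockwise `i`-bubble of degree `2k`,
that is with `mu_i - mu_{i+1} - 1 + k` dots. -/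
noncomputable def degC (lam : Weight n) (A : List (Letter n)) (i : ZMod n) (k : ℕ)
    (B : List (Letter n)) : Pre n :=
  if 0 ≤ bar (wt lam B) i - 1 + k then cbub lam A i (bar (wt lam B) i - 1 + k).toNat B
  else fakeC lam A i B k

/-- The (real or fake) counter-clockwise `i`-bubble of degree `2k`,
that is with `-(mu_i - mu_{i+1}) - 1 + k` dots. -/
noncomputable def degCC (lam : Weight n) (A : List (Letter n)) (i : ZMod n) (k : ℕ)
    (B : List (Letter n)) : Pre n :=
  if 0 ≤ -bar (wt lam B) i - 1 + k then ccbub lam A i (-bar (wt lam B) i - 1 + k).toNat B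
  else fakeCC lam A i B k

/-- The strand coloured `u` crosses the strands coloured `V`: `u V → V u`. -/
noncomputable def strandCross (lam : Weight n) (u : ZMod n) :
    List (Letter n) → List (ZMod n) → List (Letter n) → Pre n
  | A, [], B => idn lam (A ++ E u :: B)
  | A, v :: V, B => strandCross lam u (A ++ [E v]) V B * sl lam A (crossE u v) (Es V ++ B)

/-- The strands coloured `U` cross the strands coloured `V`, without crossing each other:
`U V → V U`. -/
noncomputable def blockCross (lam : Weight n) :
    List (Letter n) → List (ZMod n) → List (ZMod n) → List (Letter n) → Pre n
  | A, [], V, B => idn lam (A ++ Es V ++ B)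
  | A, u :: U, V, B =>
      strandCross lam u A V (Es U ++ B) * blockCross lam (A ++ [E u]) U V B

/-- For `i ≠ j`: the crossing `(i, …, j+1)(j, …, i+1) → (j, …, i+1)(i, …, j+1)` of two
blocks of upward strands, from `E_i E_{i-1} … E_{i+1}` to `E_j E_{j-1} … E_{j+1}`. -/
noncomputable def cyclePerm (lam : Weight n) (A : List (Letter n)) (i j : ZMod n)
    (B : List (Letter n)) : Pre n :=
  blockCross lam A (run i (i - j).val) (run j (j - i).val) B

/-- The dot on the strand of colour `c` of `E_i E_{i-1} … E_{i+1}`. -/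
noncomputable def dotOn (lam : Weight n) (A : List (Letter n)) (i c : ZMod n)
    (B : List (Letter n)) : Pre n :=
  sl lam (A ++ Es (run i (i - c).val)) (dotE c) (Es (run (c - 1) (n - 1 - (i - c).val)) ++ B)

end Diagrams

/-! ### Relations -/

/-- The defining relations of the `2`-category. Throughout, `A` and `B` are the identity strands to
the left and to the right. -/
inductive Rel (n : ℕ) [NeZero n] : Pre n → Pre n → Prop
  -- Identities and composability.
  | idn_mul_idn (lam X) : Rel n (idn lam X * idn lam X) (idn lam X)
  | idn_orth (lam mu X Y) (h : (lam, X) ≠ (mu, Y)) : Rel n (idn lam X * idn mu Y) 0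
  | sl_source (lam A g B) : Rel n (sl lam A g B * idn lam (A ++ g.dom ++ B)) (sl lam A g B)
  | sl_target (lam A g B) : Rel n (idn lam (A ++ g.cod ++ B) * sl lam A g B) (sl lam A g B)
  -- Interchange law.
  | interchange (lam A) (g : Gen n) (M) (h : Gen n) (B) :
      Rel n (sl lam A g (M ++ h.cod ++ B) * sl lam (A ++ g.dom ++ M) h B)
        (sl lam (A ++ g.cod ++ M) h B * sl lam A g (M ++ h.dom ++ B))
  -- Diagrams with an inadmissible region are zero.
  | inadmissible (lam X) (h : ¬ Admissible lam X) : Rel n (idn lam X) 0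
  -- Biadjointness, for strands of all kinds and orientations.
  | zigzag (lam A a B) :
      Rel n (sl lam A (cap a) (a :: B) * sl lam (A ++ [a]) (cup a.dual) B) (idn lam (A ++ a :: B))
  | zagzig (lam A a B) :
      Rel n (sl lam (A ++ [a]) (cap a.dual) B * sl lam A (cup a) (a :: B)) (idn lam (A ++ a :: B))
  -- Full cyclicity, in both directions of rotation.
  | cyclic (lam A g g' B) (h : Rotates g g') :
      Rel n (nestedCap lam A g.cod B * sl lam A g (dualWord g.cod ++ B))
        (nestedCap lam A g.dom B * sl lam (A ++ g.dom) g' B)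
  -- Dots and crossings.
  | slide_left (lam A i j B) (h : i ≠ j) :
      Rel n (sl lam A (crossE i j) B * dotL lam A i j B)
        (dotR lam A j i B * sl lam A (crossE i j) B)
  | slide_right (lam A i j B) (h : i ≠ j) :
      Rel n (sl lam A (crossE i j) B * dotR lam A i j B)
        (dotL lam A j i B * sl lam A (crossE i j) B)
  | nilHecke₁ (lam A i B) :
      Rel n (dotL lam A i i B * sl lam A (crossE i i) B - sl lam A (crossE i i) B * dotR lam A i i B)
        (idn lam (A ++ E i :: E i :: B))
  | nilHecke₂ (lam A i B) :
      Rel n (sl lam A (crossE i i) B * dotL lam A i i B - dotR lam A i i B * sl lam A (crossE i i) B)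
        (idn lam (A ++ E i :: E i :: B))
  -- Reidemeister 2 for upward strands.
  | r2_same (lam A i B) : Rel n (sl lam A (crossE i i) B * sl lam A (crossE i i) B) 0
  | r2_far (lam A i j B) (h : i ≠ j) (h₁ : j ≠ i + 1) (h₂ : i ≠ j + 1) :
      Rel n (sl lam A (crossE j i) B * sl lam A (crossE i j) B) (idn lam (A ++ E i :: E j :: B))
  | r2_up (lam A i B) :
      Rel n (sl lam A (crossE (i + 1) i) B * sl lam A (crossE i (i + 1)) B)
        (dotR lam A i (i + 1) B - dotL lam A i (i + 1) B)
  | r2_down (lam A i B) :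
      Rel n (sl lam A (crossE i (i + 1)) B * sl lam A (crossE (i + 1) i) B)
        (dotL lam A (i + 1) i B - dotR lam A (i + 1) i B)
  -- Reidemeister 3 for upward strands.
  | r3 (lam A i j k B) (h : ¬ (i = k ∧ (j = i + 1 ∨ i = j + 1))) :
      Rel n (braidL lam A i j k B) (braidR lam A i j k B)
  | r3_down (lam A i B) :
      Rel n (braidL lam A (i + 1) i (i + 1) B - braidR lam A (i + 1) i (i + 1) B)
        (idn lam (A ++ E (i + 1) :: E i :: E (i + 1) :: B))
  | r3_up (lam A i B) :
      Rel n (braidR lam A i (i + 1) i B - braidL lam A i (i + 1) i B)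
        (idn lam (A ++ E i :: E (i + 1) :: E i :: B))
  -- Mixed relations for different colours.
  | mixed_EF (lam A i j B) (h : i ≠ j) :
      Rel n (sideL lam A i j B * sideR lam A j i B) (idn lam (A ++ E j :: F i :: B))
  | mixed_FE (lam A i j B) (h : i ≠ j) :
      Rel n (sideR lam A j i B * sideL lam A i j B) (idn lam (A ++ F i :: E j :: B))
  -- Bubbles of negative degree, of degree zero, and the infinite Grassmannian relation.
  | cbub_neg (lam A i) (k : ℕ) (B) (h : (k : ℤ) < bar (wt lam B) i - 1) :
      Rel n (cbub lam A i k B) 0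
  | ccbub_neg (lam A i) (k : ℕ) (B) (h : (k : ℤ) < -bar (wt lam B) i - 1) :
      Rel n (ccbub lam A i k B) 0
  | cbub_zero (lam A i) (k : ℕ) (B) (h : (k : ℤ) = bar (wt lam B) i - 1) :
      Rel n (cbub lam A i k B) (bubSign lam i B • idn lam (A ++ B))
  | ccbub_zero (lam A i) (k : ℕ) (B) (h : (k : ℤ) = -bar (wt lam B) i - 1) :
      Rel n (ccbub lam A i k B) ((-bubSign lam i B) • idn lam (A ++ B))
  | grassmannian (lam A i) (k : ℕ) (B) :
      Rel n (∑ p ∈ Finset.HasAntidiagonal.antidiagonal k, degCC lam A i p.1 B * degC lam A i p.2 B)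
        (if k = 0 then -idn lam (A ++ B) else 0)
  -- Removal of curls.
  | curl_right (lam A i B) :
      Rel n (sl lam (A ++ [E i]) (cap (E i)) B * sl lam A (crossE i i) (F i :: B) *
          sl lam (A ++ [E i]) (cup (E i)) B)
        (-∑ f ∈ Finset.range (1 - bar (wt lam B) i).toNat,
          sl lam A (dotE i) B ^ ((-bar (wt lam B) i).toNat - f) * degC lam (A ++ [E i]) i f B)
  | curl_left (lam A i B) :
      Rel n (sl lam A (cap (F i)) (E i :: B) * sl lam (A ++ [F i]) (crossE i i) B *
          sl lam A (cup (F i)) (E i :: B))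
        (∑ f ∈ Finset.range (1 + bar (wt lam (E i :: B)) i).toNat,
          degCC lam A i f (E i :: B) *
            sl lam A (dotE i) B ^ ((bar (wt lam (E i :: B)) i).toNat - f))
  -- Decomposition of `E_i F_i` and `F_i E_i`.
  | decomp_EF (lam A i B) :
      Rel n (idn lam (A ++ E i :: F i :: B))
        (sideL lam A i i B * sideR lam A i i B -
          ∑ f ∈ Finset.range (bar (wt lam B) i).toNat, ∑ g ∈ Finset.range (f + 1),
            sl lam A (dotE i) (F i :: B) ^ (f - g) * sl lam A (cup (E i)) B *
              degCC lam A i g B *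
              (sl lam A (cap (E i)) B *
                sl lam A (dotE i) (F i :: B) ^ ((bar (wt lam B) i).toNat - 1 - f)))
  | decomp_FE (lam A i B) :
      Rel n (idn lam (A ++ F i :: E i :: B))
        (sideR lam A i i B * sideL lam A i i B -
          ∑ f ∈ Finset.range (-bar (wt lam B) i).toNat, ∑ g ∈ Finset.range (f + 1),
            sl lam (A ++ [F i]) (dotE i) B ^ (f - g) * sl lam A (cup (F i)) B *
              degC lam A i g B *
              (sl lam A (cap (F i)) B *
                sl lam (A ++ [F i]) (dotE i) B ^ ((-bar (wt lam B) i).toNat - 1 - f)))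
  -- `delta` and `delta'` are inverse to each other.
  | delta_bubble (lam A a B) (ha : a = delta ∨ a = delta') (h : wt lam B = oneWt n) :
      Rel n (sl lam A (cap a) B * sl lam A (cup a) B) (idn lam (A ++ B))
  | delta_invert (lam A a B) (ha : a = delta ∨ a = delta') :
      Rel n (sl lam A (cup a) B * sl lam A (cap a) B) (idn lam (A ++ a :: a.dual :: B))
  -- Splitters followed or preceded by the crossing of one strand with all the others.
  | split_cross_left (lam A i B) :
      Rel n (cyclePerm lam A i (i + 1) B * sl lam A (splitE i) B)
        ((dotOn lam A (i + 1) (i + 1) B - dotOn lam A (i + 1) i B) * sl lam A (splitE (i + 1)) B)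
  | split_cross_right (lam A i B) :
      Rel n (cyclePerm lam A i (i - 1) B * sl lam A (splitE i) B)
        ((dotOn lam A (i - 1) (i + 1) B - dotOn lam A (i - 1) i B) * sl lam A (splitE (i - 1)) B)
  | cross_merge_left (lam A i B) :
      Rel n (sl lam A (mergeE i) B * cyclePerm lam A (i + 1) i B)
        (sl lam A (mergeE (i + 1)) B * (dotOn lam A (i + 1) (i + 1) B - dotOn lam A (i + 1) i B))
  | cross_merge_right (lam A i B) :
      Rel n (sl lam A (mergeE i) B * cyclePerm lam A (i - 1) i B)
        (sl lam A (mergeE (i - 1)) B * (dotOn lam A (i - 1) (i + 1) B - dotOn lam A (i - 1) i B))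
  -- `delta F_i` and `F_i delta`.
  | delta_F (lam A i B) :
      Rel n (sl lam A (mergeE (i - 1)) (F i :: B) *
          sl lam (A ++ Es (run (i - 1) (n - 1))) (cup (E i)) B *
          sl lam (A ++ Es (run (i - 1) (n - 1))) (cap (E i)) B *
          sl lam A (splitE (i - 1)) (F i :: B))
        (idn lam (A ++ delta :: F i :: B))
  | F_delta (lam A i B) :
      Rel n (sl lam (A ++ [F i]) (mergeE i) B *
          sl lam A (cup (F i)) (Es (run (i - 1) (n - 1)) ++ B) *
          sl lam A (cap (F i)) (Es (run (i - 1) (n - 1)) ++ B) *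
          sl lam (A ++ [F i]) (splitE i) B)
        (idn lam (A ++ F i :: delta :: B))
  -- Merging and splitting again.
  | merge_split_same (lam A i B) :
      Rel n (sl lam A (splitE i) B * sl lam A (mergeE i) B)
        (dotOn lam A i (i + 1) B - dotOn lam A i i B)
  | merge_split_perm (lam A i j B) (h : i ≠ j) :
      Rel n (sl lam A (splitE j) B * sl lam A (mergeE i) B) (cyclePerm lam A i j B)

/-- The path algebra of the `2`-category: `2`-morphisms of all degrees, under vertical
composition. -/
abbrev SchurTwo (n : ℕ) [NeZero n] := RingQuot (Rel n)

/-- The `2`-morphism represented by a linear combination of diagrams. -/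
noncomputable def twoMor {n : ℕ} [NeZero n] : Pre n →ₐ[ℚ] SchurTwo n :=
  RingQuot.mkAlgHom ℚ (Rel n)

/-! ### Polygons and boxes -/

section Boxes

variable {n : ℕ}

/-- The polygon: a delta-strand which splits into `n` strands of colours `i, i-1, …, i+1`, the strand
of colour `c` carrying `s c` dots, which merge again into a delta-strand. -/
noncomputable def polygon (i : ZMod n) (s : ZMod n → ℕ) : Pre n :=
  sl (oneWt n) [] (mergeE i) [] *
    ((run i n).map fun c => dotOn (oneWt n) [] i c [] ^ s c).prod *
    sl (oneWt n) [] (splitE i) []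

/-- The box `z_m` to the left of an upward delta-strand: minus the sum of the dotless
counter-clockwise bubbles of colours `i-1, i-2, …, m` (no colours if `m = i`). -/
noncomputable def zBox (i m : ZMod n) : Pre n :=
  -((run (i - 1) (i - m).val).map fun c => ccbub (oneWt n) [] c 0 [delta]).sum

/-- The box `y_m` to the right of an upward delta-strand: the sum of the dotless
clockwise bubbles of colours `m, m-1, …, i+2` (no colours if `m = i+1`). -/
noncomputable def yBox (i m : ZMod n) : Pre n :=
  ((run m (m - (i + 1)).val).map fun c => cbub (oneWt n) [delta] c 0 []).sum

/-- Families `j` with `0 ≤ j m ≤ s m` for all `m ≠ i`; the unused entry `j i` is set to `0`. -/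
def familiesAvoiding [NeZero n] (i : ZMod n) (s : ZMod n → ℕ) : Finset (ZMod n → ℕ) :=
  Fintype.piFinset fun m => if m = i then {0} else Finset.range (s m + 1)

end Boxes

end AffineSchur

open AffineSchur

/-!
Write `x_c` for the dot on the strand of colour `c` of the word `E_i E_{i-1} … E_{i+1}`, and `S`, `M`
for the splitter and the merger between this word and `delta`.

A polygon whose only dots lie on an outer strand is a bubble next to the delta-strand
(`polygon_left`, `polygon_right`): the relation for `F_i delta` (or `delta F_{i+1}`) writes the
identity of the adjacent bubble strand and the delta-strand as a composite in which the delta-strand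
splits and merges, and zigzags straighten the result.

All other dots are moved to an outer strand. The key fact is that
`(x_{m+1} - x_m) S = S (b_m ⊗ 1)` for every colour `m`, where `b_m` is the dotless `m`-bubble in
`(1^n)` (`dot_succ_mul_splitter`). For `m = i` and `m = i + 1` this follows from the relations
between splitters and mergers. For the other colours, pull `b_m` through `S` into the region to the
left of the strands (`cbub_run_mul_splitter`). It slides freely over the strands of distant colours,
and at the strand of colour `m + 1` it becomes, by Reidemeister 2, `x_{m+1}` times an `m`-bubble
without dots minus an `m`-bubble with one dot (`cbub_slide_succ`). These are next to the strand of
colour `m`, in a region where the entries of the weight at `m`, `m + 1` are `1`, `0`, and there an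
`m`-bubble with `k` dots equals `x_m ^ k` (`cbub_absorb`).

Summing up, `x_m S = x_i S + S (z_m ⊗ 1)`. As the dotless polygon is both `b_m ⊗ 1` and
`1 ⊗ b_{m+1}` (for the splitter at `m`), also `x_m S = x_{i+1} S + S (1 ⊗ y_m)`. The two formulas are
the resulting binomial expansions (`mul_prod_pow_mul_eq_sum_choose`).
-/

namespace AffineSchur

/-! ### A binomial expansion -/

section Binomial

variable {R : Type*} [Ring R] [Algebra ℚ R]

/-- If multiplying `S` by `d` on the left amounts to multiplying it by `x` on the left plus by `z`
on the right, then the powers of `d` act on `S` by the binomial theorem. -/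
theorem pow_mul_eq_sum_choose {d x z S : R} (h : d * S = x * S + S * z) (hd : Commute d x) (k : ℕ) :
    d ^ k * S = ∑ j ∈ Finset.range (k + 1), ((k.choose j : ℕ) : ℚ) • (x ^ (k - j) * S * z ^ j) := by
  have hpow : d ^ k * S = ((LinearMap.mulRight ℚ z + LinearMap.mulLeft ℚ x) ^ k) S := by
    induction k with
    | zero => simp
    | succ k ih =>
      rw [pow_succ (_ + _ : Module.End ℚ R), ((Commute.refl _).pow_left k).eq,
        Module.End.mul_apply, ← ih, pow_succ, mul_assoc, h, mul_add, ← mul_assoc,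
        (hd.pow_left k).eq]
      simp [mul_assoc, add_comm]
  have hc : Commute (LinearMap.mulRight ℚ z) (LinearMap.mulLeft ℚ x) :=
    (LinearMap.commute_mulLeft_right x z).symm
  rw [hpow, hc.add_pow, LinearMap.sum_apply]
  refine Finset.sum_congr rfl fun j _ => ?_
  rw [← Nat.cast_comm, ← nsmul_eq_mul, LinearMap.smul_apply, Nat.cast_smul_eq_nsmul,
    Module.End.mul_apply, LinearMap.pow_mulLeft, LinearMap.pow_mulRight]
  simp

variable {ι : Type*} [Fintype ι] [DecidableEq ι]

/-- Families of natural numbers bounded by `s` on the list `L` and zero elsewhere. -/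
def familiesOn (L : List ι) (s : ι → ℕ) : Finset (ι → ℕ) :=
  Fintype.piFinset fun m => if m ∈ L then Finset.range (s m + 1) else {0}

theorem mem_familiesOn {L : List ι} {s j : ι → ℕ} :
    j ∈ familiesOn L s ↔ ∀ m, (m ∈ L → j m ≤ s m) ∧ (m ∉ L → j m = 0) := by
  rw [familiesOn, Fintype.mem_piFinset]
  refine forall_congr' fun m => ?_
  by_cases hm : m ∈ L <;> simp [hm]

theorem sum_familiesOn_cons {V : Type*} [AddCommMonoid V] {c : ι} {L : List ι} (hc : c ∉ L)
    (s : ι → ℕ) (f : (ι → ℕ) → V) :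
    ∑ j ∈ familiesOn (c :: L) s, f j =
      ∑ j ∈ familiesOn L s, ∑ k ∈ Finset.range (s c + 1), f (Function.update j c k) := by
  rw [← Finset.sum_product']
  refine Finset.sum_bij' (fun j _ => (Function.update j c 0, j c))
    (fun p _ => Function.update p.1 c p.2) ?_ ?_ ?_ ?_ ?_
  · intro j hj
    rw [mem_familiesOn] at hj
    rw [Finset.mem_product, mem_familiesOn, Finset.mem_range, Nat.lt_succ_iff]
    refine ⟨fun m => ?_, (hj c).1 (by simp)⟩
    rcases eq_or_ne m c with rfl | hm
    · simp [hc]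
    · simpa [hm] using hj m
  · rintro ⟨j, k⟩ hp
    rw [Finset.mem_product, mem_familiesOn, Finset.mem_range, Nat.lt_succ_iff] at hp
    rw [mem_familiesOn]
    intro m
    rcases eq_or_ne m c with rfl | hm
    · simpa using hp.2
    · simpa [hm] using hp.1 m
  · intro j _
    simp
  · rintro ⟨j, k⟩ hp
    rw [Finset.mem_product, mem_familiesOn] at hp
    have : j c = 0 := (hp.1 c).2 hc
    simp [← this]
  · intro j _
    simp

theorem sum_le_of_mem_familiesOn {L : List ι} (hL : L.Nodup) {s j : ι → ℕ}
    (hj : j ∈ familiesOn L s) : ∑ m, j m ≤ (L.map s).sum := by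
  rw [mem_familiesOn] at hj
  rw [← List.sum_toFinset _ hL,
    ← Finset.sum_subset (Finset.subset_univ L.toFinset) fun m _ hm => (hj m).2 (by simpa using hm)]
  exact Finset.sum_le_sum fun m hm => (hj m).1 (by simpa using hm)

/-- The binomial expansion of a product of powers acting on `S`. -/
theorem prod_pow_mul_eq_sum_choose {L : List ι} (hL : L.Nodup) {D z : ι → R} {x S : R}
    (h : ∀ c ∈ L, D c * S = x * S + S * z c) (hD : ∀ c ∈ L, Commute (D c) x) (s : ι → ℕ) :
    (L.map fun c => D c ^ s c).prod * S =
      ∑ j ∈ familiesOn L s, ((∏ m, (s m).choose (j m) : ℕ) : ℚ) •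
        (x ^ ((L.map s).sum - ∑ m, j m) * S * (L.map fun c => z c ^ j c).prod) := by
  induction L with
  | nil =>
    have : familiesOn ([] : List ι) s = {0} := by
      ext j
      simp [mem_familiesOn, funext_iff]
    simp [this]
  | cons c L ih =>
    obtain ⟨hc, hL'⟩ := List.nodup_cons.1 hL
    rw [List.map_cons, List.prod_cons, mul_assoc,
      ih hL' (fun d hd => h d (by simp [hd])) (fun d hd => hD d (by simp [hd])),
      Finset.mul_sum, sum_familiesOn_cons hc]
    refine Finset.sum_congr rfl fun j hj => ?_
    have hjc : j c = 0 := (mem_familiesOn.1 hj c).2 hc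
    have hcomm := ((hD c (by simp)).pow_left (s c)).pow_right ((L.map s).sum - ∑ m, j m)
    rw [mul_smul_comm, mul_assoc, ← mul_assoc, hcomm.eq, mul_assoc, ← mul_assoc (D c ^ s c),
      pow_mul_eq_sum_choose (h c (by simp)) (hD c (by simp)), Finset.sum_mul, Finset.mul_sum,
      Finset.smul_sum]
    refine Finset.sum_congr rfl fun k hk => ?_
    have hprod : ∏ m, (s m).choose (Function.update j c k m) =
        (∏ m, (s m).choose (j m)) * (s c).choose k := by
      rw [Fintype.prod_eq_mul_prod_compl c, Fintype.prod_eq_mul_prod_compl c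
        (fun m => (s m).choose (j m)), hjc, Nat.choose_zero_right, one_mul, mul_comm,
        Function.update_self]
      congr 1
      refine Finset.prod_congr rfl fun m hm => ?_
      rw [Function.update_of_ne (by simpa using hm)]
    have hsum : ∑ m, Function.update j c k m = k + ∑ m, j m := by
      rw [Fintype.sum_eq_add_sum_compl c, Fintype.sum_eq_add_sum_compl c j, hjc, zero_add,
        Function.update_self]
      congr 1
      refine Finset.sum_congr rfl fun m hm => ?_
      rw [Function.update_of_ne (by simpa using hm)]
    have hlist : (L.map fun d => z d ^ Function.update j c k d) = L.map fun d => z d ^ j d := by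
      refine List.map_congr_left fun d hd => ?_
      rw [Function.update_of_ne (ne_of_mem_of_not_mem hd hc)]
    have hexp : ((c :: L).map s).sum - (k + ∑ m, j m) =
        ((L.map s).sum - ∑ m, j m) + (s c - k) := by
      have h1 := sum_le_of_mem_familiesOn hL' hj
      have h2 := Finset.mem_range.1 hk
      rw [List.map_cons, List.sum_cons]
      omega
    rw [hprod, hsum, hexp, List.map_cons, List.prod_cons, hlist, Function.update_self, pow_add,
      Nat.cast_mul, mul_smul, smul_mul_assoc, mul_smul_comm]
    simp only [mul_assoc]

/-- The expansion of `prod_pow_mul_eq_sum_choose`, closed up by `M` on the left. -/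
theorem mul_prod_pow_mul_eq_sum_choose {L : List ι} (hL : L.Nodup) {D z : ι → R} {a : ι} {M S : R}
    (h : ∀ c ∈ L, D c * S = D a * S + S * z c) (hD : ∀ c ∈ L, Commute (D c) (D a))
    (hz : ∀ c ∈ L, ∀ k, Commute (z c) (M * D a ^ k * S)) (s : ι → ℕ) :
    M * (D a ^ s a * (L.map fun c => D c ^ s c).prod) * S =
      ∑ j ∈ familiesOn L s, ((∏ m, (s m).choose (j m) : ℕ) : ℚ) •
        ((L.map fun c => z c ^ j c).prod *
          (M * D a ^ (s a + (L.map s).sum - ∑ m, j m) * S)) := by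
  have e : M * (D a ^ s a * (L.map fun c => D c ^ s c).prod) * S =
      M * D a ^ s a * ((L.map fun c => D c ^ s c).prod * S) := by simp only [mul_assoc]
  rw [e, prod_pow_mul_eq_sum_choose hL h hD, Finset.mul_sum]
  refine Finset.sum_congr rfl fun j hj => ?_
  have hcomm : Commute (L.map fun c => z c ^ j c).prod
      (M * D a ^ (s a + (L.map s).sum - ∑ m, j m) * S) := by
    refine Commute.list_prod_left _ _ fun y hy => ?_
    obtain ⟨c, hc, rfl⟩ := List.mem_map.1 hy
    exact (hz c hc _).pow_left _
  rw [hcomm.eq, Nat.add_sub_assoc (sum_le_of_mem_familiesOn hL hj), pow_add, mul_smul_comm]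
  simp only [mul_assoc]

end Binomial

open Letter Gen

section Slices

variable {n : ℕ} [NeZero n]

/-! ### Slices in the path algebra -/

/-- The `2`-morphism given by a single slice. -/
noncomputable def slice (lam : Weight n) (A : List (Letter n)) (g : Gen n)
    (B : List (Letter n)) : SchurTwo n :=
  twoMor (sl lam A g B)

/-- The identity `2`-morphism of `E_X 1_lam`. -/
noncomputable def ident (lam : Weight n) (X : List (Letter n)) : SchurTwo n :=
  twoMor (idn lam X)

theorem twoMor_eq_of_rel {a b : Pre n} (h : Rel n a b) : twoMor a = twoMor b :=
  RingQuot.mkAlgHom_rel ℚ h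

theorem twoMor_sl (lam : Weight n) (A : List (Letter n)) (g : Gen n) (B : List (Letter n)) :
    twoMor (sl lam A g B) = slice lam A g B := rfl

theorem twoMor_idn (lam : Weight n) (X : List (Letter n)) :
    twoMor (idn lam X) = ident lam X := rfl

theorem slice_mul_ident (lam : Weight n) (A : List (Letter n)) (g : Gen n) (B : List (Letter n))
    {X : List (Letter n)} (hX : X = A ++ g.dom ++ B) :
    slice lam A g B * ident lam X = slice lam A g B := by
  subst hX
  simpa only [map_mul, twoMor_sl, twoMor_idn] using twoMor_eq_of_rel (Rel.sl_source lam A g B)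

theorem ident_mul_slice (lam : Weight n) (A : List (Letter n)) (g : Gen n) (B : List (Letter n))
    {X : List (Letter n)} (hX : X = A ++ g.cod ++ B) :
    ident lam X * slice lam A g B = slice lam A g B := by
  subst hX
  simpa only [map_mul, twoMor_sl, twoMor_idn] using twoMor_eq_of_rel (Rel.sl_target lam A g B)

/-- The interchange law. The outer words are variables constrained by equations, so that the lemma
applies to words in any normal form. -/
theorem slice_interchange (lam : Weight n) (A : List (Letter n)) (g : Gen n)
    (M : List (Letter n)) (h : Gen n) (B : List (Letter n)) {C D C' D' : List (Letter n)}
    (hC : C = M ++ h.cod ++ B) (hD : D = A ++ g.dom ++ M)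
    (hC' : C' = M ++ h.dom ++ B) (hD' : D' = A ++ g.cod ++ M) :
    slice lam A g C * slice lam D h B = slice lam D' h B * slice lam A g C' := by
  subst hC hD hC' hD'
  simpa only [map_mul, twoMor_sl, twoMor_idn] using twoMor_eq_of_rel (Rel.interchange lam A g M h B)

theorem cap_mul_cup_right (lam : Weight n) (A : List (Letter n)) (a : Letter n)
    (B : List (Letter n)) :
    slice lam A (cap a) (a :: B) * slice lam (A ++ [a]) (cup a.dual) B =
      ident lam (A ++ a :: B) := by
  simpa only [map_mul, twoMor_sl, twoMor_idn] using twoMor_eq_of_rel (Rel.zigzag lam A a B)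

theorem cap_mul_cup_left (lam : Weight n) (A : List (Letter n)) (a : Letter n)
    (B : List (Letter n)) :
    slice lam (A ++ [a]) (cap a.dual) B * slice lam A (cup a) (a :: B) =
      ident lam (A ++ a :: B) := by
  simpa only [map_mul, twoMor_sl, twoMor_idn] using twoMor_eq_of_rel (Rel.zagzig lam A a B)

/-! ### Admissibility -/

theorem Admissible.of_append {lam : Weight n} {A B : List (Letter n)}
    (h : Admissible lam (A ++ B)) : Admissible lam B := by
  induction A with
  | nil => exact h
  | cons a A ih => exact ih h.1

theorem Admissible.isSchurWeight_wt {lam : Weight n} {B : List (Letter n)}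
    (h : Admissible lam B) : IsSchurWeight (wt lam B) := by
  cases B with
  | nil => exact h
  | cons a B => exact h.2.1

theorem ident_eq_zero_of_wt_neg (lam : Weight n) (A B : List (Letter n)) (j : ZMod n)
    (h : wt lam B j < 0) : ident lam (A ++ B) = 0 := by
  have := twoMor_eq_of_rel (Rel.inadmissible lam (A ++ B)
    fun hA => not_lt.2 (hA.of_append.isSchurWeight_wt.1 j) h)
  simpa [twoMor_idn] using this

/-! ### Bubbles -/

theorem twoMor_cbub (lam : Weight n) (A : List (Letter n)) (i : ZMod n) (k : ℕ)
    (B : List (Letter n)) :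
    twoMor (cbub lam A i k B) = slice lam A (cap (E i)) B *
      slice lam A (dotE i) (F i :: B) ^ k * slice lam A (cup (E i)) B := by
  simp only [cbub, map_mul, map_pow, twoMor_sl]

theorem twoMor_ccbub (lam : Weight n) (A : List (Letter n)) (i : ZMod n) (k : ℕ)
    (B : List (Letter n)) :
    twoMor (ccbub lam A i k B) = slice lam A (cap (F i)) B *
      slice lam (A ++ [F i]) (dotE i) B ^ k * slice lam A (cup (F i)) B := by
  simp only [ccbub, map_mul, map_pow, twoMor_sl]

/-- A clockwise bubble commutes with every slice to its right. -/
theorem cbub_mul_slice (lam : Weight n) (A : List (Letter n)) (i : ZMod n) (k : ℕ)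
    (M : List (Letter n)) (h : Gen n) (B : List (Letter n)) :
    twoMor (cbub lam A i k (M ++ h.cod ++ B)) * slice lam (A ++ M) h B =
      slice lam (A ++ M) h B * twoMor (cbub lam A i k (M ++ h.dom ++ B)) := by
  have h1 := slice_interchange lam A (cup (E i)) M h B rfl
    (D := A ++ M) (by simp [Gen.dom]) rfl rfl
  have h2 : SemiconjBy (slice lam (A ++ (E i :: F i :: M)) h B)
      (slice lam A (dotE i) (F i :: (M ++ h.dom ++ B)))
      (slice lam A (dotE i) (F i :: (M ++ h.cod ++ B))) :=
    (slice_interchange lam A (dotE i) (F i :: M) h B (by simp)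
      (by simp [Gen.dom]) (by simp) (by simp [Gen.cod])).symm
  have h3 := slice_interchange lam A (cap (E i)) M h B rfl
    (D := A ++ (E i :: F i :: M)) (D' := A ++ M)
    (by simp [Gen.dom, Letter.dual]) rfl (by simp [Gen.cod])
  replace h1 : slice lam A (cup (E i)) (M ++ h.cod ++ B) * slice lam (A ++ M) h B =
      slice lam (A ++ (E i :: F i :: M)) h B * slice lam A (cup (E i)) (M ++ h.dom ++ B) := by
    simpa [Gen.cod, Letter.dual] using h1
  rw [twoMor_cbub, twoMor_cbub, mul_assoc, h1, ← mul_assoc, mul_assoc (slice _ _ (cap _) _),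
    ← (h2.pow_right k).eq, ← mul_assoc, h3]
  simp only [mul_assoc]

/-- Two bubbles in the same place commute: slide one of them past the other. -/
theorem commute_cbub_ccbub (lam : Weight n) (A : List (Letter n)) (i j : ZMod n) (k l : ℕ)
    (B : List (Letter n)) :
    Commute (twoMor (cbub lam A i k B)) (twoMor (ccbub lam A j l B)) := by
  have h1 : SemiconjBy (slice lam A (cup (F j)) B) (twoMor (cbub lam A i k B))
      (twoMor (cbub lam A i k (F j :: E j :: B))) := by
    simpa [Gen.dom, Gen.cod, Letter.dual, SemiconjBy] using
      (cbub_mul_slice lam A i k [] (cup (F j)) B).symm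
  have h2 : Commute (slice lam (A ++ [F j]) (dotE j) B)
      (twoMor (cbub lam A i k (F j :: E j :: B))) := by
    simpa [Gen.dom, Gen.cod, commute_iff_eq] using
      (cbub_mul_slice lam A i k [F j] (dotE j) B).symm
  have h3 : SemiconjBy (slice lam A (cap (F j)) B) (twoMor (cbub lam A i k (F j :: E j :: B)))
      (twoMor (cbub lam A i k B)) := by
    simpa [Gen.dom, Gen.cod, Letter.dual, SemiconjBy] using
      (cbub_mul_slice lam A i k [] (cap (F j)) B).symm
  rw [twoMor_ccbub]
  exact Commute.symm ((h3.mul_left (h2.pow_left l)).mul_left h1)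

/-! ### Bubble slides -/

/-- A clockwise bubble to the left of a strand of another colour can be pulled over it: both
strands of the bubble cross the strand and the bubble closes up on its right. -/
theorem cbub_slide_cross (lam : Weight n) (A : List (Letter n)) {m c : ZMod n} (hmc : m ≠ c)
    (B : List (Letter n)) :
    twoMor (cbub lam A m 0 (E c :: B)) =
      slice lam (A ++ [E c]) (cap (E m)) B *
        (slice lam A (crossE m c) (F m :: B) * slice lam A (crossE c m) (F m :: B)) *
        slice lam (A ++ [E c]) (cup (E m)) B := by
  have hR : twoMor (sideR lam (A ++ [E m]) c m B) =
      slice lam (A ++ [E m, F m, E c]) (cap (E m)) B *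
        slice lam (A ++ [E m, F m]) (crossE m c) (F m :: B) *
        slice lam (A ++ [E m]) (cup (F m)) (E c :: F m :: B) := by
    simp [sideR, twoMor_sl]
  have hL : twoMor (sideL lam (A ++ [E m]) m c B) =
      slice lam (A ++ [E m]) (cap (F m)) (E c :: F m :: B) *
        slice lam (A ++ [E m, F m]) (crossE c m) (F m :: B) *
        slice lam (A ++ [E m, F m, E c]) (cup (E m)) B := by
    simp [sideL, twoMor_sl]
  have hid : twoMor (sideR lam (A ++ [E m]) c m B) * twoMor (sideL lam (A ++ [E m]) m c B) =
      ident lam (A ++ E m :: F m :: E c :: B) := by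
    simpa [map_mul, twoMor_idn] using twoMor_eq_of_rel (Rel.mixed_FE lam (A ++ [E m]) m c B hmc)
  -- By interchange and a zigzag, the lower half of the bubble is a single crossing.
  have bot : twoMor (sideL lam (A ++ [E m]) m c B) * slice lam A (cup (E m)) (E c :: B) =
      slice lam A (crossE c m) (F m :: B) * slice lam (A ++ [E c]) (cup (E m)) B := by
    have e1 := slice_interchange lam A (cup (E m)) [E c] (cup (E m)) B
      (C := E c :: E m :: F m :: B) (D := A ++ [E c]) (C' := E c :: B) (D' := A ++ [E m, F m, E c])
      (by simp [Gen.cod, Letter.dual]) (by simp [Gen.dom]) (by simp [Gen.dom])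
      (by simp [Gen.cod, Letter.dual])
    have e2 := slice_interchange lam A (cup (E m)) [] (crossE c m) (F m :: B)
      (C := E m :: E c :: F m :: B) (D := A) (C' := E c :: E m :: F m :: B)
      (D' := A ++ [E m, F m])
      (by simp [Gen.cod]) (by simp [Gen.dom]) (by simp [Gen.dom])
      (by simp [Gen.cod, Letter.dual])
    have e3 := cap_mul_cup_left lam A (E m) (E c :: F m :: B)
    rw [hL, mul_assoc, ← e1, mul_assoc, ← mul_assoc _ (slice lam A (cup (E m)) _), ← e2,
      ← mul_assoc, ← mul_assoc]
    erw [e3]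
    rw [ident_mul_slice _ _ _ _ (by simp [Gen.cod])]
  have top : slice lam A (cap (E m)) (E c :: B) * twoMor (sideR lam (A ++ [E m]) c m B) =
      slice lam (A ++ [E c]) (cap (E m)) B * slice lam A (crossE m c) (F m :: B) := by
    have e1 := slice_interchange lam A (cap (E m)) [E c] (cap (E m)) B
      (C := E c :: B) (D := A ++ [E m, F m, E c]) (C' := E c :: E m :: F m :: B) (D' := A ++ [E c])
      (by simp [Gen.cod]) (by simp [Gen.dom, Letter.dual])
      (by simp [Gen.dom, Letter.dual]) (by simp [Gen.cod])
    have e2 := slice_interchange lam A (cap (E m)) [] (crossE m c) (F m :: B)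
      (C := E c :: E m :: F m :: B) (D := A ++ [E m, F m]) (C' := E m :: E c :: F m :: B)
      (D' := A)
      (by simp [Gen.cod]) (by simp [Gen.dom, Letter.dual]) (by simp [Gen.dom])
      (by simp [Gen.cod])
    have e3 := cap_mul_cup_right lam A (E m) (E c :: F m :: B)
    rw [hR, ← mul_assoc, ← mul_assoc, e1, mul_assoc (slice lam (A ++ [E c]) _ _), e2, mul_assoc,
      mul_assoc]
    erw [e3]
    rw [slice_mul_ident _ _ _ _ (by simp [Gen.dom])]
  rw [twoMor_cbub, pow_zero, mul_one,
    ← ident_mul_slice lam A (cup (E m)) (E c :: B) (X := A ++ E m :: F m :: E c :: B)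
      (by simp [Gen.cod, Letter.dual]), ← hid, mul_assoc (twoMor _), bot, ← mul_assoc, top]
  simp only [mul_assoc]

/-- A dotless bubble slides through a strand whose colour is not adjacent to its own. -/
theorem cbub_slide_far (lam : Weight n) (A : List (Letter n)) {m c : ZMod n} (h : m ≠ c)
    (h₁ : m ≠ c + 1) (h₂ : c ≠ m + 1) (B : List (Letter n)) :
    twoMor (cbub lam A m 0 (E c :: B)) = twoMor (cbub lam (A ++ [E c]) m 0 B) := by
  have r2 : slice lam A (crossE m c) (F m :: B) * slice lam A (crossE c m) (F m :: B) =
      ident lam (A ++ E c :: E m :: F m :: B) := by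
    simpa only [map_mul, twoMor_sl, twoMor_idn] using
      twoMor_eq_of_rel (Rel.r2_far lam A c m (F m :: B) h.symm h₁ h₂)
  rw [cbub_slide_cross lam A h B, r2, twoMor_cbub, mul_assoc,
    ident_mul_slice _ _ _ _ (by simp [Gen.cod, Letter.dual]), pow_zero, mul_one]

theorem cbub_slide_far_word (lam : Weight n) (A : List (Letter n)) {m : ZMod n}
    (U : List (ZMod n)) (hU : ∀ c ∈ U, m ≠ c ∧ m ≠ c + 1 ∧ c ≠ m + 1) (B : List (Letter n)) :
    twoMor (cbub lam A m 0 (Es U ++ B)) = twoMor (cbub lam (A ++ Es U) m 0 B) := by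
  induction U generalizing A with
  | nil => simp [Es]
  | cons c U ih =>
    obtain ⟨h, h₁, h₂⟩ := hU c (by simp)
    have := cbub_slide_far lam A h h₁ h₂ (Es U ++ B)
    rw [ih _ fun d hd => hU d (by simp [hd])] at this
    simpa [Es] using this

/-- A dotless bubble of colour `m` to the left of a strand of colour `m + 1`. -/
theorem cbub_slide_succ (lam : Weight n) (A : List (Letter n)) {m : ZMod n} (h : m ≠ m + 1)
    (B : List (Letter n)) :
    twoMor (cbub lam A m 0 (E (m + 1) :: B)) =
      slice lam A (dotE (m + 1)) B * twoMor (cbub lam (A ++ [E (m + 1)]) m 0 B) -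
        twoMor (cbub lam (A ++ [E (m + 1)]) m 1 B) := by
  have r2 : slice lam A (crossE m (m + 1)) (F m :: B) * slice lam A (crossE (m + 1) m) (F m :: B) =
      slice lam A (dotE (m + 1)) (E m :: F m :: B) -
        slice lam (A ++ [E (m + 1)]) (dotE m) (F m :: B) := by
    simpa only [map_mul, map_sub, dotL, dotR, twoMor_sl] using
      twoMor_eq_of_rel (Rel.r2_down lam A m (F m :: B))
  have e := slice_interchange lam A (dotE (m + 1)) [] (cap (E m)) B
    (C := B) (D := A ++ [E (m + 1)]) (C' := E m :: F m :: B) (D' := A ++ [E (m + 1)])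
    (by simp [Gen.cod]) (by simp [Gen.dom]) (by simp [Gen.dom, Letter.dual]) (by simp [Gen.cod])
  rw [cbub_slide_cross lam A h B, r2, twoMor_cbub, twoMor_cbub, mul_sub, sub_mul, ← e]
  simp [mul_assoc]

/-- Stated for a general ring, since rewriting with lemmas on negatives does not see through the
instances of `RingQuot`. -/
theorem neg_mul_neg_mul {R : Type*} [Ring R] (a b c : R) : -(a * -b * c) = a * (b * c) := by
  simp [mul_assoc]

/-- To the left of a region whose label has entries `0`, `1` at `m`, `m + 1`, the identity of
`F_m E_m` factors through a cap and a cup: of the two terms of its decomposition, the sideways double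
crossing passes through a region with a negative label. -/
theorem ident_FE_eq_cup_mul_cap (lam : Weight n) (A : List (Letter n)) (m : ZMod n)
    (B : List (Letter n)) (h0 : wt lam B m = 0) (h1 : wt lam B (m + 1) = 1) :
    ident lam (A ++ F m :: E m :: B) =
      slice lam A (cup (F m)) B * slice lam A (cap (F m)) B := by
  have hm : m ≠ m + 1 := by
    intro h
    rw [← h, h0] at h1
    exact zero_ne_one h1
  -- The sideways double crossing passes through `E_m F_m`, with an entry `-1` in the middle.
  have hside : twoMor (sideL lam A m m B) = 0 := by
    have hz : ident lam ((A ++ [E m]) ++ F m :: B) = 0 := by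
      refine ident_eq_zero_of_wt_neg lam _ _ m ?_
      simp [wt, Letter.shift, simpleRoot, h0, hm]
    have : slice lam A (cap (F m)) (E m :: F m :: B) = 0 := by
      rw [← ident_mul_slice lam A (cap (F m)) (E m :: F m :: B)
        (X := (A ++ [E m]) ++ F m :: B) (by simp [Gen.cod]), hz, zero_mul]
    simp only [sideL, map_mul, twoMor_sl, this, zero_mul]
  have hbar : bar (wt lam B) m = -1 := by simp [bar, h0, h1]
  have hdeg : twoMor (degC lam A m 0 B) = -ident lam (A ++ B) := by
    simp [degC, hbar, fakeC, bubSign, h1, twoMor_idn]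
  have hr := twoMor_eq_of_rel (Rel.decomp_FE lam A m B)
  have hone : (-bar (wt lam B) m).toNat = 1 := by simp [hbar]
  rw [hone] at hr
  simp only [map_sub, map_mul, hside, hdeg, twoMor_sl, twoMor_idn,
    Finset.sum_range_one, pow_zero, Nat.sub_self, mul_zero, zero_sub, one_mul, mul_one, zero_add] at hr
  have hneg : ∀ a b c : SchurTwo n, -(a * -b * c) = a * (b * c) := neg_mul_neg_mul
  rw [hr, hneg, ident_mul_slice _ _ _ _ (by simp [Gen.cod])]

/-- Between a clockwise `m`-bubble and an `m`-strand on its right, the strands `F_m E_m` are replaced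
by a cap and a cup; this joins the bubble to the strand, and its dots move onto the strand. -/
theorem cbub_absorb (lam : Weight n) (A : List (Letter n)) (m : ZMod n) (k : ℕ)
    (B : List (Letter n)) (h0 : wt lam B m = 0) (h1 : wt lam B (m + 1) = 1) :
    twoMor (cbub lam A m k (E m :: B)) =
      slice lam A (dotE m) B ^ k * ident lam (A ++ E m :: B) := by
  have hid : ident lam (A ++ E m :: F m :: E m :: B) =
      slice lam (A ++ [E m]) (cup (F m)) B * slice lam (A ++ [E m]) (cap (F m)) B := by
    simpa using ident_FE_eq_cup_mul_cap lam (A ++ [E m]) m B h0 h1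
  have e : SemiconjBy (slice lam (A ++ [E m]) (cup (F m)) B)
      (slice lam A (dotE m) B) (slice lam A (dotE m) (F m :: E m :: B)) :=
    (slice_interchange lam A (dotE m) [] (cup (F m)) B
      (by simp [Gen.cod, Letter.dual]) (by simp [Gen.dom]) (by simp [Gen.dom])
      (by simp [Gen.cod])).symm
  have z1 : slice lam A (cap (E m)) (E m :: B) * slice lam (A ++ [E m]) (cup (F m)) B =
      ident lam (A ++ E m :: B) := cap_mul_cup_right lam A (E m) B
  have z2 : slice lam (A ++ [E m]) (cap (F m)) B * slice lam A (cup (E m)) (E m :: B) =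
      ident lam (A ++ E m :: B) := cap_mul_cup_left lam A (E m) B
  have hcomm : SemiconjBy (ident lam (A ++ E m :: B))
      (slice lam A (dotE m) B) (slice lam A (dotE m) B) := by
    rw [SemiconjBy, ident_mul_slice _ _ _ _ (by simp [Gen.cod]),
      slice_mul_ident _ _ _ _ (by simp [Gen.dom])]
  have hidem : ident lam (A ++ E m :: B) * ident lam (A ++ E m :: B) = ident lam (A ++ E m :: B) := by
    simpa only [map_mul, twoMor_sl, twoMor_idn] using twoMor_eq_of_rel (Rel.idn_mul_idn lam (A ++ E m :: B))
  rw [twoMor_cbub,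
    ← ident_mul_slice lam A (cup (E m)) (E m :: B) (X := A ++ E m :: F m :: E m :: B)
      (by simp [Gen.cod, Letter.dual]), hid]
  calc _ = slice lam A (cap (E m)) (E m :: B) *
        (slice lam A (dotE m) (F m :: E m :: B) ^ k * slice lam (A ++ [E m]) (cup (F m)) B) *
        (slice lam (A ++ [E m]) (cap (F m)) B * slice lam A (cup (E m)) (E m :: B)) := by
        simp only [mul_assoc]
    _ = _ := by
        rw [← (e.pow_right k).eq, z2, ← mul_assoc, z1, (hcomm.pow_right k).eq, mul_assoc, hidem]

end Slices

/-! ### Runs of colours -/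

section Runs

variable {n : ℕ}

/-- The definition of `run` elaborates to a map over the list of casts of `0, …, m - 1`. -/
theorem run_eq_map (i : ZMod n) (m : ℕ) :
    run i m = (List.range m).map fun k : ℕ => i - (k : ZMod n) := by
  have h : (List.range m).flatMap (fun a : ℕ => [(a : ZMod n)]) =
      (List.range m).map fun a : ℕ => (a : ZMod n) := List.flatMap_pure_eq_map _ _
  simp [run, h]

theorem run_zero (i : ZMod n) : run i 0 = [] := rfl

theorem run_succ (i : ZMod n) (m : ℕ) : run i (m + 1) = i :: run (i - 1) m := by
  simp only [run_eq_map, List.range_succ_eq_map, List.map_cons, List.map_map, Nat.cast_zero,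
    sub_zero]
  congr 1
  refine List.map_congr_left fun k _ => ?_
  simp only [Function.comp, Nat.succ_eq_add_one, Nat.cast_add, Nat.cast_one]
  ring

theorem run_add (i : ZMod n) (a b : ℕ) :
    run i (a + b) = run i a ++ run (i - (a : ZMod n)) b := by
  induction a generalizing i with
  | zero => simp [run_zero]
  | succ a ih =>
    have h : i - 1 - (a : ZMod n) = i - ((a + 1 : ℕ) : ZMod n) := by
      push_cast
      ring
    rw [Nat.add_right_comm, run_succ, ih, run_succ, h, List.cons_append]

theorem mem_run {i c : ZMod n} {m : ℕ} : c ∈ run i m ↔ ∃ k < m, i - (k : ZMod n) = c := by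
  simp [run]

theorem Es_append (U V : List (ZMod n)) : Es (U ++ V) = Es U ++ Es V := by simp [Es]

theorem Es_cons (u : ZMod n) (U : List (ZMod n)) : Es (u :: U) = E u :: Es U := rfl

/-- The roots along a run telescope. -/
theorem wt_run (lam : Weight n) (i : ZMod n) (l : ℕ) :
    wt lam (Es (run i l)) = lam + Pi.single (i - l + 1) 1 - Pi.single (i + 1) 1 := by
  induction l generalizing i with
  | zero => simp [run_zero, Es, wt]
  | succ l ih =>
    rw [run_succ, Es_cons, wt, ih, Letter.shift, simpleRoot]
    have : i - ((l + 1 : ℕ) : ZMod n) + 1 = i - 1 - l + 1 := by push_cast; ring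
    rw [this, sub_add_cancel]
    abel

theorem nodup_run {i : ZMod n} {m : ℕ} (hm : m ≤ n) : (run i m).Nodup := by
  rw [run_eq_map]
  refine List.Nodup.map_on (fun a ha b hb hab => ?_) List.nodup_range
  rw [List.mem_range] at ha hb
  have := (ZMod.natCast_eq_natCast_iff' a b n).1 (sub_right_injective hab)
  rwa [Nat.mod_eq_of_lt (ha.trans_le hm), Nat.mod_eq_of_lt (hb.trans_le hm)] at this

variable [NeZero n]

theorem run_self (i : ZMod n) : run i n = i :: run (i - 1) (n - 1) := by
  rw [← run_succ, Nat.sub_add_cancel (Nat.pos_of_ne_zero (NeZero.ne n))]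

theorem run_self_last (i : ZMod n) : run i n = run i (n - 1) ++ [i + 1] := by
  have h : n - 1 + 1 = n := Nat.sub_add_cancel (Nat.pos_of_ne_zero (NeZero.ne n))
  have hc : ((n - 1 : ℕ) : ZMod n) = -1 := by
    rw [eq_neg_iff_add_eq_zero, ← Nat.cast_one (R := ZMod n), ← Nat.cast_add, h, ZMod.natCast_self]
  have := run_add i (n - 1) 1
  rwa [show run (i - ((n - 1 : ℕ) : ZMod n)) 1 = [i - ((n - 1 : ℕ) : ZMod n)] by
    rw [run_succ, run_zero], hc, sub_neg_eq_add, h] at this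

theorem run_split (i c : ZMod n) :
    run i n = run i (i - c).val ++ c :: run (c - 1) (n - 1 - (i - c).val) := by
  have h : (i - c).val + (n - 1 - (i - c).val + 1) = n := by
    have := ZMod.val_lt (i - c)
    omega
  have := run_add i (i - c).val (n - 1 - (i - c).val + 1)
  rwa [run_succ, ZMod.natCast_zmod_val, sub_sub_cancel, h] at this

theorem mem_run_sub_one {i c : ZMod n} : c ∈ run (i - 1) (n - 1) ↔ c ≠ i := by
  have hnd := nodup_run (i := i) le_rfl
  have hall : c ∈ run i n := by rw [run_split i c]; simp
  rw [run_self] at hnd hall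
  rw [List.nodup_cons] at hnd
  constructor
  · rintro h rfl
    exact hnd.1 h
  · intro h
    exact (List.mem_cons.1 hall).resolve_left h

end Runs

/-! ### Polygons with dots on an outer strand -/

section Polygons

variable {n : ℕ} [NeZero n]

/-- The left strand of a polygon can be detached from the delta-strand: inserting the composite
`F_i delta → E_{i-1} … E_{i+1} → F_i delta`, which is the identity, at the right strand of the bubble
and the delta-strand gives the polygon up to two zigzags. -/
theorem polygon_left (lam : Weight n) (A : List (Letter n)) (i : ZMod n) (k : ℕ)
    (B : List (Letter n)) :
    slice lam A (mergeE i) B * slice lam A (dotE i) (Es (run (i - 1) (n - 1)) ++ B) ^ k *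
      slice lam A (splitE i) B = twoMor (cbub lam A i k (delta :: B)) := by
  set R := Es (run (i - 1) (n - 1)) with hR
  have hrun : Es (run i n) = E i :: R := by rw [run_self, Es_cons]
  have hid : slice lam (A ++ [E i, F i]) (mergeE i) B * slice lam (A ++ [E i]) (cup (F i)) (R ++ B) *
      slice lam (A ++ [E i]) (cap (F i)) (R ++ B) * slice lam (A ++ [E i, F i]) (splitE i) B =
      ident lam (A ++ E i :: F i :: delta :: B) := by
    simpa [map_mul, twoMor_sl, twoMor_idn] using twoMor_eq_of_rel (Rel.F_delta lam (A ++ [E i]) i B)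
  have e1 := slice_interchange lam A (cup (E i)) [] (splitE i) B
    (C := E i :: (R ++ B)) (D := A) (C' := delta :: B) (D' := A ++ [E i, F i])
    (by simp [Gen.cod, hrun]) (by simp [Gen.dom]) (by simp [Gen.dom])
    (by simp [Gen.cod, Letter.dual])
  have e2 := slice_interchange lam A (cap (E i)) [] (mergeE i) B
    (C := delta :: B) (D := A ++ [E i, F i]) (C' := E i :: (R ++ B)) (D' := A)
    (by simp [Gen.cod]) (by simp [Gen.dom, Letter.dual])
    (by simp [Gen.dom, hrun]) (by simp [Gen.cod])
  have e3 : SemiconjBy (slice lam (A ++ [E i, F i]) (mergeE i) B)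
      (slice lam A (dotE i) (F i :: E i :: (R ++ B))) (slice lam A (dotE i) (F i :: delta :: B)) :=
    (slice_interchange lam A (dotE i) [F i] (mergeE i) B (by simp [Gen.cod]) (by simp [Gen.dom])
      (by simp [Gen.dom, hrun]) (by simp [Gen.cod])).symm
  have e4 : SemiconjBy (slice lam (A ++ [E i]) (cup (F i)) (R ++ B))
      (slice lam A (dotE i) (R ++ B)) (slice lam A (dotE i) (F i :: E i :: (R ++ B))) :=
    (slice_interchange lam A (dotE i) [] (cup (F i)) (R ++ B) (by simp [Gen.cod, Letter.dual])
      (by simp [Gen.dom]) (by simp [Gen.dom]) (by simp [Gen.cod])).symm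
  have z1 : slice lam A (cap (E i)) (E i :: (R ++ B)) * slice lam (A ++ [E i]) (cup (F i)) (R ++ B) =
      ident lam (A ++ E i :: (R ++ B)) := cap_mul_cup_right lam A (E i) (R ++ B)
  have z2 : slice lam (A ++ [E i]) (cap (F i)) (R ++ B) * slice lam A (cup (E i)) (E i :: (R ++ B)) =
      ident lam (A ++ E i :: (R ++ B)) := cap_mul_cup_left lam A (E i) (R ++ B)
  symm
  rw [twoMor_cbub, ← ident_mul_slice lam A (cup (E i)) (delta :: B)
    (X := A ++ E i :: F i :: delta :: B) (by simp [Gen.cod, Letter.dual]), ← hid]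
  calc _ = slice lam A (cap (E i)) (delta :: B) *
        (slice lam A (dotE i) (F i :: delta :: B) ^ k * slice lam (A ++ [E i, F i]) (mergeE i) B) *
        slice lam (A ++ [E i]) (cup (F i)) (R ++ B) * slice lam (A ++ [E i]) (cap (F i)) (R ++ B) *
        (slice lam (A ++ [E i, F i]) (splitE i) B * slice lam A (cup (E i)) (delta :: B)) := by
        simp only [mul_assoc]
    _ = (slice lam A (cap (E i)) (delta :: B) * slice lam (A ++ [E i, F i]) (mergeE i) B) *
        (slice lam A (dotE i) (F i :: E i :: (R ++ B)) ^ k *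
          slice lam (A ++ [E i]) (cup (F i)) (R ++ B)) *
        (slice lam (A ++ [E i]) (cap (F i)) (R ++ B) * slice lam A (cup (E i)) (E i :: (R ++ B))) *
        slice lam A (splitE i) B := by
        rw [← (e3.pow_right k).eq, ← e1]
        simp only [mul_assoc]
    _ = slice lam A (mergeE i) B *
        (slice lam A (cap (E i)) (E i :: (R ++ B)) * slice lam (A ++ [E i]) (cup (F i)) (R ++ B)) *
        slice lam A (dotE i) (R ++ B) ^ k *
        (ident lam (A ++ E i :: (R ++ B)) * slice lam A (splitE i) B) := by
        rw [← (e4.pow_right k).eq, z2, e2]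
        simp only [mul_assoc]
    _ = _ := by
        rw [z1, slice_mul_ident _ _ _ _ (by simp [Gen.dom, hrun]),
          ident_mul_slice _ _ _ _ (by simp [Gen.cod, hrun])]

/-- The right strand of a polygon can be detached from the delta-strand, by means of
`delta F_{i+1}` in place of `F_i delta`. -/
theorem polygon_right (lam : Weight n) (A : List (Letter n)) (i : ZMod n) (k : ℕ)
    (B : List (Letter n)) :
    slice lam A (mergeE i) B * slice lam (A ++ Es (run i (n - 1))) (dotE (i + 1)) B ^ k *
      slice lam A (splitE i) B = twoMor (ccbub lam (A ++ [delta]) (i + 1) k B) := by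
  obtain ⟨j, rfl⟩ : ∃ j, i = j - 1 := ⟨i + 1, by simp⟩
  rw [sub_add_cancel]
  set R := Es (run (j - 1) (n - 1)) with hR
  have hrun : Es (run (j - 1) n) = R ++ [E j] := by
    rw [run_self_last, Es_append, sub_add_cancel, Es_cons, hR]; rfl
  have hid : slice lam A (mergeE (j - 1)) (F j :: E j :: B) *
      slice lam (A ++ R) (cup (E j)) (E j :: B) * slice lam (A ++ R) (cap (E j)) (E j :: B) *
      slice lam A (splitE (j - 1)) (F j :: E j :: B) =
      ident lam (A ++ delta :: F j :: E j :: B) := by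
    simpa only [map_mul, twoMor_sl, twoMor_idn] using
      twoMor_eq_of_rel (Rel.delta_F lam A j (E j :: B))
  have e1 := slice_interchange lam A (splitE (j - 1)) [] (cup (F j)) B
    (C := F j :: E j :: B) (D := A ++ [delta]) (C' := B) (D' := A ++ R ++ [E j])
    (by simp [Gen.cod, Letter.dual]) (by simp [Gen.dom]) (by simp [Gen.dom])
    (by simp [Gen.cod, hrun])
  have e2 := slice_interchange lam A (mergeE (j - 1)) [] (cap (F j)) B
    (C := B) (D := A ++ R ++ [E j]) (C' := F j :: E j :: B) (D' := A ++ [delta])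
    (by simp [Gen.cod]) (by simp [Gen.dom, hrun])
    (by simp [Gen.dom, Letter.dual]) (by simp [Gen.cod])
  have e3 : SemiconjBy (slice lam A (mergeE (j - 1)) (F j :: E j :: B))
      (slice lam (A ++ R ++ [E j, F j]) (dotE j) B)
      (slice lam (A ++ [delta] ++ [F j]) (dotE j) B) :=
    slice_interchange lam A (mergeE (j - 1)) [F j] (dotE j) B (by simp [Gen.cod])
      (by simp [Gen.dom, hrun]) (by simp [Gen.dom]) (by simp [Gen.cod])
  have e4 : SemiconjBy (slice lam (A ++ R) (cup (E j)) (E j :: B))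
      (slice lam (A ++ R) (dotE j) B) (slice lam (A ++ R ++ [E j, F j]) (dotE j) B) :=
    slice_interchange lam (A ++ R) (cup (E j)) [] (dotE j) B (by simp [Gen.cod])
      (by simp [Gen.dom]) (by simp [Gen.dom]) (by simp [Gen.cod, Letter.dual])
  have z1 : slice lam (A ++ R ++ [E j]) (cap (F j)) B * slice lam (A ++ R) (cup (E j)) (E j :: B) =
      ident lam (A ++ R ++ E j :: B) := cap_mul_cup_left lam (A ++ R) (E j) B
  have z2 : slice lam (A ++ R) (cap (E j)) (E j :: B) * slice lam (A ++ R ++ [E j]) (cup (F j)) B =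
      ident lam (A ++ R ++ E j :: B) := cap_mul_cup_right lam (A ++ R) (E j) B
  symm
  rw [twoMor_ccbub, ← ident_mul_slice lam (A ++ [delta]) (cup (F j)) B
    (X := A ++ delta :: F j :: E j :: B) (by simp [Gen.cod, Letter.dual]), ← hid]
  calc _ = slice lam (A ++ [delta]) (cap (F j)) B *
        (slice lam (A ++ [delta] ++ [F j]) (dotE j) B ^ k *
          slice lam A (mergeE (j - 1)) (F j :: E j :: B)) *
        slice lam (A ++ R) (cup (E j)) (E j :: B) * slice lam (A ++ R) (cap (E j)) (E j :: B) *
        (slice lam A (splitE (j - 1)) (F j :: E j :: B) *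
          slice lam (A ++ [delta]) (cup (F j)) B) := by
        simp only [mul_assoc]
    _ = (slice lam (A ++ [delta]) (cap (F j)) B * slice lam A (mergeE (j - 1)) (F j :: E j :: B)) *
        (slice lam (A ++ R ++ [E j, F j]) (dotE j) B ^ k *
          slice lam (A ++ R) (cup (E j)) (E j :: B)) *
        (slice lam (A ++ R) (cap (E j)) (E j :: B) * slice lam (A ++ R ++ [E j]) (cup (F j)) B) *
        slice lam A (splitE (j - 1)) B := by
        rw [← (e3.pow_right k).eq, e1]
        simp only [mul_assoc]
    _ = slice lam A (mergeE (j - 1)) B *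
        (slice lam (A ++ R ++ [E j]) (cap (F j)) B * slice lam (A ++ R) (cup (E j)) (E j :: B)) *
        slice lam (A ++ R) (dotE j) B ^ k *
        (ident lam (A ++ R ++ E j :: B) * slice lam A (splitE (j - 1)) B) := by
        rw [← (e4.pow_right k).eq, z2, ← e2]
        simp only [mul_assoc]
    _ = _ := by
        rw [z1, slice_mul_ident _ _ _ _ (by simp [Gen.dom, hrun]),
          ident_mul_slice _ _ _ _ (by simp [Gen.cod, hrun])]

/-- Stated for a general module, to avoid unification with the instances of `RingQuot`. -/
theorem eq_of_neg_smul_add_smul_eq_zero {V : Type*} [AddCommGroup V] [Module ℚ V] {c : ℚ}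
    (hc : c ≠ 0) {x y : V} (h : -(c • x) + c • y = 0) : y = x :=
  smul_right_injective V hc (neg_add_eq_zero.1 h).symm

/-- In a region labelled with equal entries at `i` and `i + 1`, where `i`-bubbles without dots have
degree two, the Grassmannian relation identifies the two orientations. -/
theorem ccbub_zero_eq_cbub_zero (lam : Weight n) (A : List (Letter n)) (i : ZMod n)
    (B : List (Letter n)) (h : bar (wt lam B) i = 0) :
    twoMor (ccbub lam A i 0 B) = twoMor (cbub lam A i 0 B) := by
  have hg := twoMor_eq_of_rel (Rel.grassmannian lam A i 1 B)
  have hl : twoMor (idn lam (A ++ B)) * twoMor (cbub lam A i 0 B) = twoMor (cbub lam A i 0 B) := by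
    rw [twoMor_cbub, twoMor_idn, mul_assoc, ← mul_assoc,
      ident_mul_slice _ _ _ _ (by simp [Gen.cod])]
  have hr : twoMor (ccbub lam A i 0 B) * twoMor (idn lam (A ++ B)) =
      twoMor (ccbub lam A i 0 B) := by
    rw [twoMor_ccbub, twoMor_idn, mul_assoc, slice_mul_ident _ _ _ _ (by simp [Gen.dom])]
  simp [Finset.Nat.antidiagonal_succ, degC, degCC, h, fakeC, fakeCC, bubSign, hl, hr] at hg
  exact eq_of_neg_smul_add_smul_eq_zero (zpow_ne_zero _ (by norm_num)) hg

end Polygons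

/-! ### Dots on a splitter -/

section Dots

variable {n : ℕ} [NeZero n]

/-- The upward splitter of a delta-strand in `(1^n)`. -/
noncomputable def splitter (i : ZMod n) : SchurTwo n := slice (oneWt n) [] (splitE i) []

/-- The upward merger into a delta-strand in `(1^n)`. -/
noncomputable def merger (i : ZMod n) : SchurTwo n := slice (oneWt n) [] (mergeE i) []

/-- The dot on the strand of colour `c` of `E_i E_{i-1} … E_{i+1}`. -/
noncomputable def dot (i c : ZMod n) : SchurTwo n := twoMor (dotOn (oneWt n) [] i c [])

theorem dot_eq_slice (i c : ZMod n) :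
    dot i c = slice (oneWt n) (Es (run i (i - c).val)) (dotE c)
      (Es (run (c - 1) (n - 1 - (i - c).val))) := by
  simp [dot, dotOn, twoMor_sl]

theorem twoMor_polygon (i : ZMod n) (s : ZMod n → ℕ) :
    twoMor (polygon i s) =
      merger i * ((run i n).map fun c => dot i c ^ s c).prod * splitter i := by
  simp only [polygon, map_mul, map_list_prod, List.map_map, Function.comp_def, map_pow]
  rfl

theorem dot_first (i : ZMod n) :
    dot i i = slice (oneWt n) [] (dotE i) (Es (run (i - 1) (n - 1))) := by
  simp [dot_eq_slice, run_zero, Es]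

theorem dot_last (i : ZMod n) :
    dot i (i + 1) = slice (oneWt n) (Es (run i (n - 1))) (dotE (i + 1)) [] := by
  have h : (i - (i + 1)).val = n - 1 := by
    obtain ⟨k, rfl⟩ := Nat.exists_eq_succ_of_ne_zero (NeZero.ne n)
    rw [sub_add_cancel_left, ZMod.val_neg_one]
    rfl
  rw [dot_eq_slice, h, Nat.sub_self, run_zero]
  rfl

theorem merger_mul_dot_first_pow_mul_splitter (i : ZMod n) (k : ℕ) :
    merger i * dot i i ^ k * splitter i = twoMor (cbub (oneWt n) [] i k [delta]) := by
  simpa [dot_first, merger, splitter] using polygon_left (oneWt n) [] i k []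

theorem merger_mul_dot_last_pow_mul_splitter (i : ZMod n) (k : ℕ) :
    merger i * dot i (i + 1) ^ k * splitter i =
      twoMor (ccbub (oneWt n) [delta] (i + 1) k []) := by
  simpa [dot_last, merger, splitter] using polygon_right (oneWt n) [] i k []

theorem commute_dot (i c d : ZMod n) : Commute (dot i c) (dot i d) := by
  wlog h : (i - c).val < (i - d).val generalizing c d
  · rcases (not_lt.1 h).eq_or_lt with h | h
    · have : d = c := by simpa using ZMod.val_injective n h
      rw [this]
    · exact (this d c h).symm
  have hd := ZMod.val_lt (i - d)
  obtain ⟨q, hq⟩ : ∃ q, (i - d).val = (i - c).val + 1 + q := ⟨_, (Nat.add_sub_cancel' h).symm⟩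
  have hc : i - ((i - c).val : ZMod n) = c := by
    rw [ZMod.natCast_zmod_val, sub_sub_cancel]
  have hdc : c - 1 - (q : ZMod n) = d := by
    have : (((i - d).val : ℕ) : ZMod n) = ((i - c).val + 1 + q : ℕ) := by rw [hq]
    push_cast at this
    rw [ZMod.natCast_zmod_val, ZMod.natCast_zmod_val] at this
    linear_combination this
  have hD : run i (i - d).val = run i (i - c).val ++ c :: run (c - 1) q := by
    rw [hq, add_assoc, add_comm 1 q, run_add, hc, run_succ]
  have hC : run (c - 1) (n - 1 - (i - c).val) =
      run (c - 1) q ++ d :: run (d - 1) (n - 1 - (i - d).val) := by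
    have : n - 1 - (i - c).val = q + (n - 1 - (i - d).val + 1) := by omega
    rw [this, run_add, hdc, run_succ]
  rw [dot_eq_slice, dot_eq_slice, hD, hC, commute_iff_eq]
  exact slice_interchange (oneWt n) (Es (run i (i - c).val)) (dotE c) (Es (run (c - 1) q)) (dotE d)
    (Es (run (d - 1) (n - 1 - (i - d).val))) (by simp [Es, Gen.cod]) (by simp [Es, Gen.dom])
    (by simp [Es, Gen.dom]) (by simp [Es, Gen.cod])

/-- The bubble to the left of a delta-strand equals the bubble of the next colour to its right:
both are the polygon without dots. -/
theorem cbub_delta_eq_delta_cbub (m : ZMod n) :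
    twoMor (cbub (oneWt n) [] m 0 [delta]) = twoMor (cbub (oneWt n) [delta] (m + 1) 0 []) := by
  rw [← merger_mul_dot_first_pow_mul_splitter, pow_zero,
    ← ccbub_zero_eq_cbub_zero _ _ _ _ (by simp [bar, wt, oneWt]),
    ← merger_mul_dot_last_pow_mul_splitter, pow_zero]

theorem cbub_mul_splitter (i m : ZMod n) (k : ℕ) :
    twoMor (cbub (oneWt n) [] m k (Es (run i n))) * splitter i =
      splitter i * twoMor (cbub (oneWt n) [] m k [delta]) := by
  simpa [Gen.cod, Gen.dom, splitter] using cbub_mul_slice (oneWt n) [] m k [] (splitE i) []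

/-- A bubble of colour `m` to the left of the strands `i, …, i + 1` passes the strands before
`m + 1`, which have distant colours, and turns into a difference of dots at the strands `m + 1`
and `m`. This requires `m + 1` to stand just before `m` (so `m ≠ i`) and the strand `m - 1` to stand
behind `m` (so `m ≠ i + 1`). -/
theorem cbub_run_mul_splitter {i m : ZMod n} (hn : 3 ≤ n) (h : m ≠ i) (h' : m ≠ i + 1) :
    twoMor (cbub (oneWt n) [] m 0 (Es (run i n))) * splitter i =
      (dot i (m + 1) - dot i m) * splitter i := by
  have hm1 : m ≠ m + 1 := by
    have : Fact (1 < n) := ⟨by omega⟩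
    simp
  obtain ⟨p, hp⟩ : ∃ p, p = (i - (m + 1)).val := ⟨_, rfl⟩
  have hpn : p < n := hp ▸ ZMod.val_lt _
  have hpi : (p : ZMod n) = i - (m + 1) := by rw [hp, ZMod.natCast_zmod_val]
  -- The strand `m + 1`, at position `p`, is neither the last one nor the last but one.
  have hp1 : p + 1 ≠ n := by
    intro hpn1
    have : ((p + 1 : ℕ) : ZMod n) = 0 := by rw [hpn1, ZMod.natCast_self]
    push_cast at this
    exact h (by linear_combination hpi - this)
  have hp2 : p + 2 ≠ n := by
    intro hpn2
    have : ((p + 2 : ℕ) : ZMod n) = 0 := by rw [hpn2, ZMod.natCast_self]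
    push_cast at this
    exact h' (by linear_combination hpi - this)
  obtain ⟨l, hl⟩ : ∃ l, n = p + (l + 2) := ⟨n - p - 2, by omega⟩
  have hval : (i - m).val = p + 1 := by
    have : i - m = ((p + 1 : ℕ) : ZMod n) := by push_cast; linear_combination -hpi
    rw [this, ZMod.val_natCast_of_lt (by omega)]
  set U := run i p with hU
  set V := Es (run (m - 1) l) with hV
  have hm : i - ((p + 1 : ℕ) : ZMod n) = m := by push_cast; linear_combination -hpi
  have hUsucc : run i (p + 1) = U ++ [m + 1] := by
    rw [run_add, show run (i - (p : ZMod n)) 1 = [i - (p : ZMod n)] by rw [run_succ, run_zero],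
      hpi, sub_sub_cancel]
  have hrun : Es (run i n) = Es U ++ E (m + 1) :: E m :: V := by
    have h1 : run i n = run i (p + 1 + (l + 1)) := congrArg (run i) (by omega)
    rw [h1, run_add, hm, hUsucc, run_succ]
    simp [Es, hV]
  have hfar : ∀ c ∈ U, m ≠ c ∧ m ≠ c + 1 ∧ c ≠ m + 1 := by
    intro c hc
    obtain ⟨q, hq, rfl⟩ := mem_run.1 hc
    -- The strand `c` stands `p - q` places before `m + 1`, and `1 ≤ p - q ≤ n - 3`.
    have key : ∀ t : ℕ, t ≤ 2 → 0 < t + (p - q) → m + 1 + ((p - q : ℕ) : ZMod n) + t ≠ m + 1 := by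
      intro t ht hpos he
      have h0 : ((p - q + t : ℕ) : ZMod n) = 0 := by push_cast; linear_combination he
      rw [ZMod.natCast_eq_zero_iff] at h0
      have := Nat.le_of_dvd (by omega) h0
      omega
    have hqp : i - (q : ZMod n) = m + 1 + ((p - q : ℕ) : ZMod n) := by
      rw [Nat.cast_sub hq.le]
      linear_combination -hpi
    rw [hqp]
    refine ⟨fun he => key 1 (by omega) (by omega) ?_, fun he => key 2 le_rfl (by omega) ?_,
      fun he => key 0 (by omega) (by omega) ?_⟩
    · push_cast; linear_combination -he
    · push_cast; linear_combination -he
    · push_cast; linear_combination he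
  -- To the right of the strand `m`, the entry at `m` is `0`, as `m ≠ i + 1`.
  have hwt : wt (oneWt n) V = oneWt n + Pi.single (i + 1) 1 - Pi.single m 1 := by
    have e : m - 1 - (l : ZMod n) + 1 = i + 1 := by
      have : ((p + (l + 2) : ℕ) : ZMod n) = 0 := by rw [← hl, ZMod.natCast_self]
      push_cast at this
      linear_combination hpi - this
    rw [hV, wt_run, e, sub_add_cancel]
  have h0 : wt (oneWt n) V m = 0 := by
    rw [hwt]
    simp [oneWt, h']
  have h1 : wt (oneWt n) V (m + 1) = 1 := by
    rw [hwt]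
    simp [oneWt, h.symm, hm1.symm]
  have hident : ident (oneWt n) (Es (run i n)) * splitter i = splitter i :=
    ident_mul_slice _ _ _ _ (by simp [Gen.cod])
  have hd1 : dot i (m + 1) = slice (oneWt n) (Es U) (dotE (m + 1)) (E m :: V) := by
    have : n - 1 - p = l + 1 := by omega
    rw [dot_eq_slice, ← hp, this, run_succ, add_sub_cancel_right]
    rfl
  have hd0 : dot i m = slice (oneWt n) (Es U ++ [E (m + 1)]) (dotE m) V := by
    have : n - 1 - (p + 1) = l := by omega
    rw [dot_eq_slice, hval, this, hUsucc, Es_append]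
    rfl
  rw [hrun] at hident ⊢
  have hslide := cbub_slide_far_word (oneWt n) [] U hfar (E (m + 1) :: E m :: V)
  rw [List.nil_append] at hslide
  rw [hslide, cbub_slide_succ _ _ hm1, cbub_absorb _ _ _ _ _ h0 h1, cbub_absorb _ _ _ _ _ h0 h1,
    pow_zero, one_mul, pow_one, ← hd1, ← hd0, ← sub_mul, mul_assoc]
  simp only [List.append_assoc, List.singleton_append]
  rw [hident]

/-- On a splitter, consecutive dots differ by a bubble to the left of the delta-strand. -/
theorem dot_succ_mul_splitter (hn : 3 ≤ n) (i m : ZMod n) :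
    dot i (m + 1) * splitter i =
      dot i m * splitter i + splitter i * twoMor (cbub (oneWt n) [] m 0 [delta]) := by
  rw [← sub_eq_iff_eq_add', ← sub_mul]
  by_cases h : m = i
  · -- Both sides are `S_i M_i S_i`.
    subst h
    have hr := twoMor_eq_of_rel (Rel.merge_split_same (oneWt n) [] m [])
    rw [map_sub, map_mul] at hr
    rw [← merger_mul_dot_first_pow_mul_splitter, pow_zero, mul_one, ← mul_assoc]
    exact congrArg (· * splitter m) hr.symm
  by_cases h' : m = i + 1
  · -- Both sides are `S_i M_{i+1} S_{i+1}`.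
    subst h'
    have hr := twoMor_eq_of_rel (Rel.merge_split_perm (oneWt n) [] (i + 1) i [] h)
    have hs := twoMor_eq_of_rel (Rel.split_cross_right (oneWt n) [] (i + 1) [])
    rw [add_sub_cancel_right, map_mul, map_mul, map_sub, ← hr, map_mul] at hs
    rw [← merger_mul_dot_first_pow_mul_splitter, pow_zero, mul_one, ← mul_assoc]
    exact hs.symm
  · rw [← cbub_mul_splitter, cbub_run_mul_splitter hn h h']

/-- Stated for a general ring, to avoid rewriting negatives in `RingQuot`. -/
theorem eq_add_mul_neg_add {R : Type*} [Ring R] {x y a z b : R} (h : x + a * -z = y + a * b) :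
    y = x + a * -(z + b) := by
  rw [neg_add, mul_add, ← add_assoc, h]
  simp

/-- On a splitter, a dot can be moved to the leftmost strand at the cost of a box on the left of
the delta-strand. -/
theorem dot_mul_splitter_left (hn : 3 ≤ n) (i m : ZMod n) :
    dot i m * splitter i = dot i i * splitter i + splitter i * twoMor (zBox i m) := by
  obtain ⟨q, hq⟩ : ∃ q, q = (i - m).val := ⟨_, rfl⟩
  have hm : m = i - (q : ZMod n) := by rw [hq, ZMod.natCast_zmod_val, sub_sub_cancel]
  rw [zBox, ← hq, hm]
  clear hq hm
  induction q with
  | zero => simp [run_zero]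
  | succ q ih =>
    have hd := dot_succ_mul_splitter hn i (i - ((q + 1 : ℕ) : ZMod n))
    have e1 : i - ((q + 1 : ℕ) : ZMod n) + 1 = i - (q : ZMod n) := by push_cast; ring
    have e2 : run (i - 1) (q + 1) = run (i - 1) q ++ [i - ((q + 1 : ℕ) : ZMod n)] := by
      rw [run_add, show run (i - 1 - (q : ZMod n)) 1 = [i - 1 - (q : ZMod n)] by
        rw [run_succ, run_zero]]
      push_cast
      congr 2
      ring
    rw [e1, ih] at hd
    rw [e2, List.map_append, List.sum_append, List.map_singleton, List.sum_singleton, map_neg,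
      map_add, ccbub_zero_eq_cbub_zero _ _ _ _ (by simp [bar, wt, oneWt, Letter.shift])]
    rw [map_neg] at hd
    exact eq_add_mul_neg_add hd

/-- On a splitter, a dot can be moved to the rightmost strand at the cost of a box on the right of
the delta-strand. -/
theorem dot_mul_splitter_right (hn : 3 ≤ n) (i m : ZMod n) :
    dot i m * splitter i = dot i (i + 1) * splitter i + splitter i * twoMor (yBox i m) := by
  obtain ⟨q, hq⟩ : ∃ q, q = (m - (i + 1)).val := ⟨_, rfl⟩
  have hm : m = i + 1 + (q : ZMod n) := by rw [hq, ZMod.natCast_zmod_val, add_sub_cancel]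
  rw [yBox, ← hq, hm]
  clear hq hm
  induction q with
  | zero => simp [run_zero]
  | succ q ih =>
    have hd := dot_succ_mul_splitter hn i (i + 1 + (q : ZMod n))
    have e1 : i + 1 + ((q + 1 : ℕ) : ZMod n) = i + 1 + (q : ZMod n) + 1 := by push_cast; ring
    rw [cbub_delta_eq_delta_cbub, ih] at hd
    rw [e1, hd, run_succ, add_sub_cancel_right, List.map_cons, List.sum_cons, map_add, mul_add,
      add_assoc, add_comm (splitter i * twoMor (cbub _ _ _ _ _))]

end Dots

end AffineSchur

open AffineSchur

theorem mainTheorem5 (n : ℕ) [NeZero n] (hn : 3 ≤ n) (i : ZMod n) (s : ZMod n → ℕ) :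
    twoMor (polygon i s) =
      twoMor (∑ j ∈ familiesAvoiding i s,
        ((∏ m, (s m).choose (j m) : ℕ) : ℚ) •
          (((run (i - 1) (n - 1)).map fun m => zBox i m ^ j m).prod *
            cbub (oneWt n) [] i (∑ m, s m - ∑ m, j m) [Letter.delta])) ∧
    twoMor (polygon i s) =
      twoMor (∑ j ∈ familiesAvoiding (i + 1) s,
        ((∏ m, (s m).choose (j m) : ℕ) : ℚ) •
          (((run i (n - 1)).map fun m => yBox i m ^ j m).prod *
            ccbub (oneWt n) [Letter.delta] (i + 1) (∑ m, s m - ∑ m, j m) [])) := by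
  have hfam : ∀ a : ZMod n, familiesAvoiding a s = familiesOn (run (a - 1) (n - 1)) s := by
    intro a
    rw [familiesAvoiding, familiesOn]
    congr 1
    ext1 m
    by_cases hm : m = a <;> simp [mem_run_sub_one, hm]
  have hnd : ∀ a : ZMod n, (run a (n - 1)).Nodup := fun a => nodup_run (Nat.sub_le n 1)
  have hsum : ∀ a : ZMod n, s a + ((run (a - 1) (n - 1)).map s).sum = ∑ m, s m := by
    intro a
    rw [← List.sum_toFinset _ (hnd _), Fintype.sum_eq_add_sum_compl a]
    congr 2
    ext m
    simp [mem_run_sub_one]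
  constructor
  · rw [twoMor_polygon, run_self, List.map_cons, List.prod_cons,
      mul_prod_pow_mul_eq_sum_choose (hnd _) (fun c _ => dot_mul_splitter_left hn i c)
        (fun c _ => commute_dot i c i) ?_ s, hfam, hsum]
    · simp only [merger_mul_dot_first_pow_mul_splitter, map_sum, map_smul, map_mul, map_list_prod,
        List.map_map, Function.comp_def, map_pow]
    · intro c _ k
      rw [merger_mul_dot_first_pow_mul_splitter, zBox, map_neg, map_list_sum]
      refine (Commute.list_sum_left _ _ fun u hu => ?_).neg_left
      simp only [List.map_map, List.mem_map, Function.comp_apply] at hu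
      obtain ⟨d, _, rfl⟩ := hu
      exact (commute_cbub_ccbub _ _ _ _ _ _ _).symm
  · have hrun : ((run i n).map fun c => dot i c ^ s c).prod =
        dot i (i + 1) ^ s (i + 1) * ((run i (n - 1)).map fun c => dot i c ^ s c).prod := by
      rw [run_self_last, List.map_append, List.prod_append, List.map_singleton,
        List.prod_singleton]
      refine (Commute.list_prod_left _ _ fun u hu => ?_).eq
      obtain ⟨c, _, rfl⟩ := List.mem_map.1 hu
      exact (commute_dot i c (i + 1)).pow_pow _ _
    have hfam' := hfam (i + 1)
    have hsum' := hsum (i + 1)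
    rw [add_sub_cancel_right] at hfam' hsum'
    rw [twoMor_polygon, hrun,
      mul_prod_pow_mul_eq_sum_choose (hnd _) (fun c _ => dot_mul_splitter_right hn i c)
        (fun c _ => commute_dot i c (i + 1)) ?_ s, hfam', hsum']
    · simp only [merger_mul_dot_last_pow_mul_splitter, map_sum, map_smul, map_mul, map_list_prod,
        List.map_map, Function.comp_def, map_pow]
    · intro c _ k
      rw [merger_mul_dot_last_pow_mul_splitter, yBox, map_list_sum]
      refine Commute.list_sum_left _ _ fun u hu => ?_
      simp only [List.map_map, List.mem_map, Function.comp_apply] at hu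
      obtain ⟨d, _, rfl⟩ := hu
      exact commute_cbub_ccbub _ _ _ _ _ _ _
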